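/- Consider a quantum particle of mass $m>0$ and charge $e$ moving in the $(x,y)$-plane in a harmonic well of frequency $\omega_0>0$ and a uniform magnetic field $\mathbf B=B\hat z$ (Gaussian units, speed of light $c$), coupled to a heat bath at temperature $T>0$. Its position operators $\mathbf r=(x,y)$ obey the quantum Langevin equation $$m\ddot{\mathbf r}(t)+\int_{-\infty}^t\mu(t-t')\dot{\mathbf r}(t')\,dt'+m\omega_0^2\mathbf r(t)-\frac ec\,\dot{\mathbf r}(t)\times\mathbf B=\mathbf f(t),$$ where the real friction kernel $\mu$ is the sum of an instantaneous (Ohmic) part $\mu_0\delta(t)$ (whose whole mass acts) and a memory function integrable on $(0,\infty)$, its Fourier transform $\tilde\mu(\omega)=\int\mu(t)e^{-i\omega t}dt$ satisfies $\mathrm{Re}\,\tilde\mu(\omega)>0$ for $\omega\ne0$, and $\mathbf f$ is an operator-valued (generalized) random force with $$\langle\{f_\alpha(t),f_\beta(t')\}\rangle=\frac{2\delta_{\alpha\beta}}{\pi}\int_0^\infty\hbar\omega\,\mathrm{Re}[\tilde\mu(\omega)]\coth\Big(\frac{\hbar\omega}{2k_BT}\Big)\cos[\omega(t-t')]\,d\omega,$$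 $$\langle[f_\alpha(t),f_\beta(t')]\rangle=\frac{2\delta_{\alpha\beta}}{i\pi}\int_0^\infty\hbar\omega\,\mathrm{Re}[\tilde\mu(\omega)]\sin[\omega(t-t')]\,d\omega .$$ Let $\mathbf r$ be a steady state: a weak solution on the whole time axis, weakly continuous in time, whose two-time correlation functions are invariant under time translation. Then the equilibrium magnetic moment $M_z=\frac{|e|}{2c}\langle x(t)\dot y(t)-y(t)\dot x(t)\rangle$, where the time derivative is taken after the expectation, i.e. $M_z=\frac{|e|}{2c}\,\partial_s\langle x(t)y(s)-y(t)x(s)\rangle\big|_{s=t}$, exists, does not depend on $t$, and equals $$M_z=\frac1{2\pi}\int_{-\infty}^\infty m(\omega)\,\omega^2\,[\Phi(\omega)-\Phi(-\omega)]\,d\omega .$$ Here $m(\omega)=-\mu_B\coth\big(\frac{\hbar\omega}{2k_BT}\big)$, with $\mu_B=\frac{|e|\hbar}{2mc}$, is the thermal Bohr magneton, and, with $\tilde\gamma=\tilde\mu/m$ and $\omega_c=eB/(mc)$, $$\Phi(\omega)=\frac{\mathrm{Re}[\tilde\gamma(\omega)]}{\big(\omega^2-\omega_0^2-\omega\omega_c+\omega\,\mathrm{Im}[\tilde\gamma(\omega)]\big)^2+\big(\omega\,\mathrm{Re}[\tilde\gamma(\omega)]\big)^2}.$$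 Equivalently, $M_z=\int_{-\infty}^\infty m(\omega)\,\mathcal P_m(\omega)\,d\omega$ with $\mathcal P_m(\omega)=\pi^{-1}\omega^2\Phi(\omega)$. Both integrals converge absolutely. -/

import Mathlib

open MeasureTheory Set
open scoped SchwartzMap

noncomputable section

namespace DissipativeDiamagnetism

/-- The data of a charged particle of mass `m` and charge `e` in the plane, in a harmonic well of
frequency `ω₀` and a magnetic field `B` along the `z`-axis (Gaussian units, speed of light `c`),
and of a heat bath at temperature `T`. The bath enters through its friction kernel
`μ(t) = μ₀ δ(t) + k(t) Θ(t)`: an instantaneous (Ohmic) part, where the whole of the Dirac mass acts,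
and an integrable memory function `k` on `(0, ∞)`. -/
structure System where
  m : ℝ
  e : ℝ
  c : ℝ
  B : ℝ
  ω₀ : ℝ
  ħ : ℝ
  kB : ℝ
  T : ℝ
  μ₀ : ℝ
  k : ℝ → ℝ
  m_pos : 0 < m
  c_pos : 0 < c
  ω₀_pos : 0 < ω₀
  ħ_pos : 0 < ħ
  kB_pos : 0 < kB
  T_pos : 0 < T
  k_integrable : IntegrableOn k (Ioi 0)

/-- The hyperbolic cotangent. -/
def coth (x : ℝ) : ℝ := Real.cosh x / Real.sinh x

namespace System

variable (S : System)

/-- The Fourier transform `μ̃(ω) = ∫ μ(t) e^{-iωt} dt` of the friction kernel. -/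
def frictionFT (ω : ℝ) : ℂ :=
  (S.μ₀ : ℂ) + ∫ t in Ioi (0 : ℝ), (S.k t : ℂ) * Complex.exp (-(Complex.I * ω * t))

/-- `γ̃ = μ̃ / m`. -/
def gammaFT (ω : ℝ) : ℂ := S.frictionFT ω / (S.m : ℂ)

/-- The second law: the bath takes up energy at every frequency (at zero frequency the condition
is not imposed, so that super-Ohmic baths are allowed). -/
def IsDissipative : Prop := ∀ ω : ℝ, ω ≠ 0 → 0 < (S.frictionFT ω).re

/-- The cyclotron frequency `ω_c = eB / (mc)`. -/
def cyclotron : ℝ := S.e * S.B / (S.m * S.c)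

/-- The relaxation function `Φ`. -/
def relaxation (ω : ℝ) : ℝ :=
  (S.gammaFT ω).re /
    ((ω ^ 2 - S.ω₀ ^ 2 - ω * S.cyclotron + ω * (S.gammaFT ω).im) ^ 2
      + (ω * (S.gammaFT ω).re) ^ 2)

/-- The Bohr magneton of the particle. -/
def bohrMagneton : ℝ := |S.e| * S.ħ / (2 * S.m * S.c)

/-- The thermal Bohr magneton `m(ω) = -μ_B coth (ħω / (2 k_B T))`. -/
def thermalBohrMagneton (ω : ℝ) : ℝ :=
  -S.bohrMagneton * coth (S.ħ * ω / (2 * S.kB * S.T))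

/-- `𝒫_m(ω) = π⁻¹ ω² Φ(ω)`. -/
def momentDensity (ω : ℝ) : ℝ := Real.pi⁻¹ * ω ^ 2 * S.relaxation ω

/-- `adjointOp φ` is the formal transpose, applied to the test function `φ`, of the operator
`r ↦ m r'' + ∫_{-∞}^t μ(t - t') r'(t') dt' + m ω₀² r`; integrating `r` against it is the weak form
of integrating the latter expression against `φ`. -/
def adjointOp (φ : 𝓢(ℝ, ℝ)) (t : ℝ) : ℝ :=
  S.m * iteratedDeriv 2 φ t
    - (S.μ₀ * deriv φ t + ∫ s in Ioi (0 : ℝ), S.k s * deriv φ (t + s))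
    + S.m * S.ω₀ ^ 2 * φ t

end System

/-- A state (expectation functional) on a unital `*`-algebra over `ℂ`; the algebra plays the role
of the (possibly unbounded) operators, and `⟨a⟩` is `ρ a`. -/
def IsState {A : Type*} [Ring A] [StarRing A] [Algebra ℂ A] (ρ : A →ₗ[ℂ] ℂ) : Prop :=
  ρ 1 = 1 ∧ ∀ a : A, 0 ≤ (ρ (star a * a)).re ∧ (ρ (star a * a)).im = 0

section Dynamics

variable {A : Type*} [Ring A] [StarRing A] [Algebra ℂ A]

/-- The operator-valued random force of the bath. Since its correlation functions are in general
distributions (for example in the Ohmic case), the force is smeared with Schwartz functions: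
`f 0 φ`, `f 1 φ` stand for `∫ φ(t) f_x(t) dt`, `∫ φ(t) f_y(t) dt`. The two last fields are the
symmetric correlation
`⟨{f_α(t), f_β(t')}⟩ = (2δ_{αβ}/π) ∫₀^∞ ħω Re μ̃(ω) coth(ħω/(2k_BT)) cos(ω(t-t')) dω`
and the commutator
`⟨[f_α(t), f_β(t')]⟩ = (2δ_{αβ}/(iπ)) ∫₀^∞ ħω Re μ̃(ω) sin(ω(t-t')) dω`,
both integrated against `φ(t) ψ(t')`. -/
structure IsBathForce (S : System) (ρ : A →ₗ[ℂ] ℂ) (f : Fin 2 → 𝓢(ℝ, ℝ) →ₗ[ℝ] A) : Prop where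
  selfAdjoint : ∀ α φ, IsSelfAdjoint (f α φ)
  anticommutator : ∀ (α β : Fin 2) (φ ψ : 𝓢(ℝ, ℝ)),
    ρ (f α φ * f β ψ + f β ψ * f α φ) =
      if α = β then
        (((2 / Real.pi) * ∫ ω in Ioi (0 : ℝ),
          S.ħ * ω * (S.frictionFT ω).re * coth (S.ħ * ω / (2 * S.kB * S.T)) *
            ∫ t : ℝ, ∫ t' : ℝ, φ t * ψ t' * Real.cos (ω * (t - t')) : ℝ) : ℂ)
      else 0
  commutator : ∀ (α β : Fin 2) (φ ψ : 𝓢(ℝ, ℝ)),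
    ρ (f α φ * f β ψ - f β ψ * f α φ) =
      if α = β then
        (2 / (Complex.I * Real.pi)) * ((∫ ω in Ioi (0 : ℝ),
          S.ħ * ω * (S.frictionFT ω).re *
            ∫ t : ℝ, ∫ t' : ℝ, φ t * ψ t' * Real.sin (ω * (t - t')) : ℝ) : ℂ)
      else 0

/-- `r 0 = x` and `r 1 = y` are the position operators of the particle in the steady state under
the force `f`: they solve the quantum Langevin equation
`m r'' + ∫_{-∞}^t μ(t - t') r'(t') dt' + m ω₀² r - (e/c) r' × B = f`
on the whole time axis, in the weak sense (tested with Schwartz functions, and inside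
expectations `⟨a · ⟩` with an arbitrary `a`), and their two-time correlation functions are
invariant under time translation. Here `r' × B = (y' B, -x' B)`. -/
structure IsSteadyState (S : System) (ρ : A →ₗ[ℂ] ℂ) (f : Fin 2 → 𝓢(ℝ, ℝ) →ₗ[ℝ] A)
    (r : Fin 2 → ℝ → A) : Prop where
  selfAdjoint : ∀ α t, IsSelfAdjoint (r α t)
  continuous : ∀ (α : Fin 2) (a : A), Continuous fun t => ρ (a * r α t)
  langevin_x : ∀ (φ : 𝓢(ℝ, ℝ)) (a : A),
    (∫ t : ℝ, (S.adjointOp φ t : ℂ) * ρ (a * r 0 t))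
      + (S.e * S.B / S.c : ℝ) * (∫ t : ℝ, ((deriv φ t : ℝ) : ℂ) * ρ (a * r 1 t)) = ρ (a * f 0 φ)
  langevin_y : ∀ (φ : 𝓢(ℝ, ℝ)) (a : A),
    (∫ t : ℝ, (S.adjointOp φ t : ℂ) * ρ (a * r 1 t))
      - (S.e * S.B / S.c : ℝ) * (∫ t : ℝ, ((deriv φ t : ℝ) : ℂ) * ρ (a * r 0 t)) = ρ (a * f 1 φ)
  stationary : ∀ (α β : Fin 2) (t s h : ℝ),
    ρ (r α (t + h) * r β (s + h)) = ρ (r α t * r β s)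

/-- `M` is the magnetic moment `(|e| / 2c) ⟨x(t) y'(t) - y(t) x'(t)⟩` (at every time `t`). The
time derivative is taken after the expectation, at coinciding times: it is the derivative at
`s = t` of `(|e| / 2c) ⟨x(t) y(s) - y(t) x(s)⟩`, which makes sense also when the velocities have
infinite variance, as they do in the Ohmic case. -/
def IsMagneticMoment (S : System) (ρ : A →ₗ[ℂ] ℂ) (r : Fin 2 → ℝ → A) (M : ℝ) : Prop :=
  ∀ t : ℝ, HasDerivAt
    (fun s : ℝ => ((|S.e| / (2 * S.c) : ℝ) : ℂ) * ρ (r 0 t * r 1 s - r 1 t * r 0 s)) (M : ℂ) t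

end Dynamics

end DissipativeDiamagnetism

end

noncomputable section

open Filter Topology ProbabilityTheory ComplexConjugate
open scoped NNReal ENNReal

namespace DissipativeDiamagnetism

/-! The circular components `z_σ = x + iσy`, `σ = ±1`, decouple the Langevin equation: the magnetic
force becomes a scalar term, and on `e^{iωt}` the equation acts as multiplication by a symbol
`D_σ(ω)`. By positivity of the state and stationarity, `u ↦ ⟨z_σ(0)* z_σ(u)⟩` is positive definite.
It is continuous, so by Bochner's theorem (proved first, by Gaussian regularisation) it is the
characteristic function of a finite measure `ν_σ`. Using the equation of motion in both factors, the
force correlation tested with `φ, ψ` is `∫ |D_σ|² φ̂ conj ψ̂ dν_σ`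
(`IsSteadyState.exists_spectralMeasure`). The bath prescribes the same correlation as `π⁻¹ ∫ noise ·
φ̂ conj ψ̂ dω` (`IsBathForce.circular_correlation`).

Taking for `ψ` a Gaussian and for `φ` its translates identifies two finite measures by their
characteristic functions. Dissipation for `ω ≠ 0` and the well at `ω = 0` keep `D_σ` from vanishing,
so one may divide: `ν_σ` has density `noise / (π |D_σ|²)` (`IsSteadyState.circular_correlation`). No
homogeneous solution survives in a steady state, so the correlations are determined.

Finally `⟨z₊* z₊⟩ - ⟨z₋* z₋⟩ = 2i ⟨x(t)y(s) - y(t)x(s)⟩`, and the moment is the difference of the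
first moments of the two densities. These converge absolutely because `Φ = O(ω⁻⁴)` while the thermal
energy grows linearly. Since `|D₋(ω)|` gives `Φ(ω)` and `|D₊(ω)|` gives `Φ(-ω)`, the commutator part
`ħω` cancels and the `coth` part doubles. -/

/-! ### Bochner's theorem on the real line -/

/-- Positive-definite functions on the real line. -/
def IsPositiveDefinite (g : ℝ → ℂ) : Prop :=
  ∀ (n : ℕ) (t : Fin n → ℝ) (c : Fin n → ℂ),
    0 ≤ (∑ i, ∑ j, conj (c i) * c j * g (t j - t i)).re ∧
      (∑ i, ∑ j, conj (c i) * c j * g (t j - t i)).im = 0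

namespace IsPositiveDefinite

variable {g : ℝ → ℂ}

lemma zero_im (hg : IsPositiveDefinite g) : (g 0).im = 0 := by
  simpa using (hg 1 (fun _ => 0) (fun _ => 1)).2

lemma zero_re (hg : IsPositiveDefinite g) : 0 ≤ (g 0).re := by
  simpa using (hg 1 (fun _ => 0) (fun _ => 1)).1

lemma neg_eq (hg : IsPositiveDefinite g) (u : ℝ) : g (-u) = conj (g u) := by
  have h1 := (hg 2 ![0, u] ![1, 1]).2
  have h2 := (hg 2 ![0, u] ![1, Complex.I]).2
  have h0 := hg.zero_im
  simp [Fin.sum_univ_two] at h1 h2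
  apply Complex.ext
  · simp; linarith
  · simp; linarith

/-- Testing two points with coefficients `(1, w)`, `w = ±1, ±i`, bounds the real and the imaginary
part by `g 0` each. The sharp constant 1 is not needed. -/
lemma norm_le (hg : IsPositiveDefinite g) (u : ℝ) : ‖g u‖ ≤ 2 * (g 0).re := by
  have h1 := (hg 2 ![0, u] ![1, 1]).1
  have h2 := (hg 2 ![0, u] ![1, Complex.I]).1
  have h3 := (hg 2 ![0, u] ![1, -1]).1
  have h4 := (hg 2 ![0, u] ![1, -Complex.I]).1
  have h0 := hg.zero_im
  have hn := hg.neg_eq u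
  simp [Fin.sum_univ_two, hn] at h1 h2 h3 h4
  refine (Complex.norm_le_abs_re_add_abs_im _).trans ?_
  have ha : |(g u).re| ≤ (g 0).re := abs_le.2 ⟨by linarith, by linarith⟩
  have hb : |(g u).im| ≤ (g 0).re := abs_le.2 ⟨by linarith, by linarith⟩
  linarith

/-- The phase splits over `t j - t i` and is absorbed into the coefficients. This reduces positivity
of a transform at `ω` to the case `ω = 0`. -/
lemma modulate (hg : IsPositiveDefinite g) (ω : ℝ) :
    IsPositiveDefinite fun u => Complex.exp (-(ω * u) * Complex.I) * g u := by
  intro n t c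
  have h (i j : Fin n) : conj (c i) * c j *
      (Complex.exp (-(ω * ((t j - t i : ℝ) : ℂ)) * Complex.I) * g (t j - t i)) =
      conj (c i * Complex.exp (-(ω * t i) * Complex.I)) *
        (c j * Complex.exp (-(ω * t j) * Complex.I)) * g (t j - t i) := by
    have : Complex.exp (-(ω * ((t j - t i : ℝ) : ℂ)) * Complex.I) =
        Complex.exp (-(ω * t i) * -Complex.I) * Complex.exp (-(ω * t j) * Complex.I) := by
      rw [← Complex.exp_add]; congr 1; push_cast; ring
    rw [map_mul, ← Complex.exp_conj, this]
    simp only [map_mul, map_neg, Complex.conj_ofReal, Complex.conj_I]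
    ring
  simp only [h]
  exact hg n t (fun i => c i * Complex.exp (-(ω * t i) * Complex.I))

lemma integrable_comp (hg : IsPositiveDefinite g) (hc : Continuous g) {X : Type*}
    [MeasurableSpace X] (P : Measure X) [IsFiniteMeasure P] {F : X → ℝ} (hF : Measurable F) :
    Integrable (fun x => g (F x)) P :=
  Integrable.of_bound (hc.measurable.comp hF).aestronglyMeasurable (2 * (g 0).re)
    (ae_of_all _ fun _ => hg.norm_le _)

/-- Average the quadratic form with unit coefficients over `n` independent samples of `P`: the
diagonal gives `n g(0)`, the rest `n(n-1)` times the integral. As `n → ∞` the second term dominates,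
which avoids Riemann sums. -/
lemma integral_prod_re_nonneg (hg : IsPositiveDefinite g) (hc : Continuous g)
    (P : Measure ℝ) [IsProbabilityMeasure P] :
    0 ≤ (∫ p : ℝ × ℝ, g (p.2 - p.1) ∂(P.prod P)).re := by
  set I := ∫ p : ℝ × ℝ, g (p.2 - p.1) ∂(P.prod P) with hI
  have key (n : ℕ) : 0 ≤ (n : ℝ) * (g 0).re + n * (n - 1) * I.re := by
    have hint (i j : Fin n) : Integrable (fun t : Fin n → ℝ => g (t j - t i))
        (Measure.pi fun _ => P) :=
      hg.integrable_comp hc _ ((measurable_pi_apply j).sub (measurable_pi_apply i))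
    have hij (i j : Fin n) : ∫ t : Fin n → ℝ, g (t j - t i) ∂(Measure.pi fun _ => P) =
        if i = j then g 0 else I := by
      split_ifs with h
      · simp [h]
      · have hind : IndepFun (fun t : Fin n → ℝ => t i) (fun t => t j)
            (Measure.pi fun _ => P) :=
          (iIndepFun_pi (μ := fun _ : Fin n => P) (X := fun _ => id)
            (fun _ => aemeasurable_id)).indepFun h
        have hmap := (indepFun_iff_map_prod_eq_prod_map_map
          (measurable_pi_apply i).aemeasurable (measurable_pi_apply j).aemeasurable).1 hind
        rw [(measurePreserving_eval (fun _ : Fin n => P) i).map_eq,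
          (measurePreserving_eval (fun _ : Fin n => P) j).map_eq] at hmap
        rw [hI, ← hmap, integral_map]
        · exact ((measurable_pi_apply i).prodMk (measurable_pi_apply j)).aemeasurable
        · exact (by fun_prop : Continuous fun p : ℝ × ℝ => g (p.2 - p.1)).aestronglyMeasurable
    have hpos : 0 ≤ (∫ t : Fin n → ℝ, ∑ i, ∑ j, g (t j - t i) ∂(Measure.pi fun _ => P)).re := by
      rw [← RCLike.re_eq_complex_re, ← integral_re]
      · exact integral_nonneg fun t => by simpa using (hg n t fun _ => 1).1
      · exact integrable_finsetSum _ fun i _ => integrable_finsetSum _ fun j _ => hint i j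
    rw [integral_finsetSum _ fun i _ => integrable_finsetSum _ fun j _ => hint i j] at hpos
    simp_rw [integral_finsetSum _ fun j _ => hint _ j, hij] at hpos
    have hsum (i : Fin n) : ∑ j : Fin n, (if i = j then g 0 else I) = g 0 + (n - 1) * I := by
      have : ∀ j : Fin n, (if i = j then g 0 else I) = I + if i = j then g 0 - I else 0 := by
        intro j; split_ifs <;> ring
      simp [this, Finset.sum_add_distrib]; ring
    simp_rw [hsum] at hpos
    simp at hpos
    linarith
  by_contra! hneg
  obtain ⟨n, hn⟩ := exists_nat_gt ((g 0).re / (-I.re))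
  rw [div_lt_iff₀ (by linarith)] at hn
  have := key (n + 1)
  push_cast at this
  have h1 : (0 : ℝ) ≤ (g 0).re + n * I.re := by
    by_contra! h
    nlinarith [Nat.cast_nonneg (α := ℝ) n]
  linarith

lemma gaussianTransform_im (hg : IsPositiveDefinite g) (hc : Continuous g) (v : ℝ≥0) (ω : ℝ) :
    (∫ u, Complex.exp (-(ω * u) * Complex.I) * g u ∂(gaussianReal 0 v)).im = 0 := by
  rw [← Complex.conj_eq_iff_im, ← integral_conj]
  conv_rhs => rw [← neg_zero, ← gaussianReal_map_neg, integral_map (by fun_prop) (by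
    exact (by fun_prop : Continuous fun u : ℝ =>
      Complex.exp (-(ω * u) * Complex.I) * g u).aestronglyMeasurable)]
  refine integral_congr_ae (ae_of_all _ fun u => ?_)
  have := (hg.modulate ω).neg_eq u
  simpa using this.symm

/-- A centred Gaussian of variance `v` is the law of a difference of two independent ones of
variance `v / 2`, so the transform is a double integral of the modulated function. -/
lemma gaussianTransform_re_nonneg (hg : IsPositiveDefinite g) (hc : Continuous g) (v : ℝ≥0)
    (ω : ℝ) :
    0 ≤ (∫ u, Complex.exp (-(ω * u) * Complex.I) * g u ∂(gaussianReal 0 v)).re := by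
  have h := (hg.modulate ω).integral_prod_re_nonneg (by fun_prop) (gaussianReal 0 (v / 2))
  have hmap : Measure.map (fun p : ℝ × ℝ => p.2 - p.1)
      ((gaussianReal 0 (v / 2)).prod (gaussianReal 0 (v / 2))) = gaussianReal 0 v := by
    have h1 := gaussianReal_conv_gaussianReal (m₁ := 0) (m₂ := 0) (v₁ := v / 2) (v₂ := v / 2)
    rw [add_zero, add_halves] at h1
    rw [← h1, Measure.conv]
    have h2 : (gaussianReal 0 (v / 2)).prod (gaussianReal 0 (v / 2)) =
        Measure.map (Prod.map (fun x => -x) id)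
          ((gaussianReal 0 (v / 2)).prod (gaussianReal 0 (v / 2))) := by
      conv_lhs => enter [1]; rw [← neg_zero, ← gaussianReal_map_neg]
      conv_lhs => enter [2]; rw [← Measure.map_id (μ := gaussianReal 0 (v / 2))]
      rw [Measure.map_prod_map _ _ (by fun_prop) (by fun_prop)]
    conv_rhs => rw [h2]
    rw [Measure.map_map (by fun_prop) (by fun_prop)]
    congr 1
    ext p
    simp; ring
  rw [← hmap, integral_map (by fun_prop)]
  · exact h
  · exact (by fun_prop : Continuous fun u : ℝ =>
      Complex.exp (-(ω * u) * Complex.I) * g u).aestronglyMeasurable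

end IsPositiveDefinite

/-! ### Lévy's continuity theorem. -/

lemma exists_charFun_eq_of_tendsto {μ : ℕ → Measure ℝ} [∀ i, IsProbabilityMeasure (μ i)]
    {f : ℝ → ℂ} (hf : ContinuousAt f 0)
    (h : ∀ t, Tendsto (fun n => charFun (μ n) t) atTop (𝓝 (f t))) :
    ∃ ν : Measure ℝ, IsProbabilityMeasure ν ∧ ∀ t, charFun ν t = f t := by
  have htight := isTightMeasureSet_of_tendsto_charFun hf h
  let κ : ℕ → ProbabilityMeasure ℝ := fun n => ⟨μ n, inferInstance⟩
  have hcomp : IsCompact (closure (range κ)) := by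
    apply isCompact_closure_of_isTightMeasureSet
    convert htight
    ext x
    constructor
    · rintro ⟨_, ⟨n, rfl⟩, rfl⟩
      exact ⟨n, rfl⟩
    · rintro ⟨n, rfl⟩
      exact ⟨κ n, ⟨n, rfl⟩, rfl⟩
  -- Tightness gives relative compactness (Prokhorov); a limit along a free ultrafilter replaces the
  -- extraction of a subsequence.
  let U : Ultrafilter ℕ := hyperfilter ℕ
  obtain ⟨ν, -, hν⟩ := hcomp.ultrafilter_le_nhds (U.map κ) (by
    rw [le_principal_iff]
    exact mem_of_superset (Filter.range_mem_map) subset_closure)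
  refine ⟨ν, inferInstance, fun t => ?_⟩
  have h1 : Tendsto κ U (𝓝 ν) := hν
  rw [ProbabilityMeasure.tendsto_iff_forall_integral_rclike_tendsto ℂ] at h1
  have h2 := h1 (BoundedContinuousFunction.innerProbChar t)
  simp_rw [← charFun_eq_integral_innerProbChar] at h2
  exact tendsto_nhds_unique h2 ((h t).mono_left Nat.hyperfilter_le_atTop)

/-! ### Gaussian regularisation and the proof of Bochner's theorem. -/

namespace IsPositiveDefinite

variable {g : ℝ → ℂ}

lemma continuous_gaussianTransform (hg : IsPositiveDefinite g) (hc : Continuous g) (v : ℝ≥0) :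
    Continuous fun ω : ℝ =>
      ∫ u, Complex.exp (-(ω * u) * Complex.I) * g u ∂(gaussianReal 0 v) := by
  refine continuous_of_dominated (bound := fun _ => 2 * (g 0).re) ?_ ?_
    (integrable_const _) ?_
  · exact fun ω => (by fun_prop : Continuous fun u : ℝ =>
      Complex.exp (-(ω * u) * Complex.I) * g u).aestronglyMeasurable
  · refine fun ω => ae_of_all _ fun u => ?_
    rw [norm_mul, Complex.norm_exp]
    simpa using hg.norm_le u
  · exact ae_of_all _ fun u => by fun_prop

/-- The characteristic function of the measure with the Gaussian transform of `g` as a density. -/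
lemma charFun_withDensity_gaussianTransform (hg : IsPositiveDefinite g) (hc : Continuous g)
    (v : ℝ≥0) (x : ℝ) :
    charFun ((gaussianReal 0 v).withDensity fun ω => ENNReal.ofReal
      (∫ u, Complex.exp (-(ω * u) * Complex.I) * g u ∂(gaussianReal 0 v)).re) x =
      ∫ u, Complex.exp (-(v * (x - u) ^ 2 / 2)) * g u ∂(gaussianReal 0 v) := by
  have hcont := hg.continuous_gaussianTransform hc v
  rw [charFun_apply_real, integral_withDensity_eq_integral_toReal_smul
    (Measurable.ennreal_ofReal (by exact (Complex.continuous_re.comp hcont).measurable))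
    (by simp)]
  have h1 (ω : ℝ) : (ENNReal.ofReal
      (∫ u, Complex.exp (-(ω * u) * Complex.I) * g u ∂(gaussianReal 0 v)).re).toReal •
        Complex.exp (x * ω * Complex.I) =
      ∫ u, Complex.exp (ω * (x - u) * Complex.I) * g u ∂(gaussianReal 0 v) := by
    rw [ENNReal.toReal_ofReal (hg.gaussianTransform_re_nonneg hc v ω), Complex.real_smul]
    have : (((∫ u, Complex.exp (-(ω * u) * Complex.I) * g u ∂(gaussianReal 0 v)).re : ℝ) : ℂ) =
        ∫ u, Complex.exp (-(ω * u) * Complex.I) * g u ∂(gaussianReal 0 v) :=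
      Complex.ext (by simp) ((Complex.ofReal_im _).trans (hg.gaussianTransform_im hc v ω).symm)
    rw [this, mul_comm, ← integral_const_mul]
    refine integral_congr_ae (ae_of_all _ fun u => ?_)
    simp only
    rw [← mul_assoc, ← Complex.exp_add]
    congr 2
    ring
  simp_rw [h1]
  rw [integral_integral_swap]
  · refine integral_congr_ae (ae_of_all _ fun u => ?_)
    simp only
    rw [integral_mul_const]
    congr 1
    have := charFun_gaussianReal (μ := 0) (v := v) (x - u)
    rw [charFun_apply_real] at this
    push_cast at this
    rw [show -((v : ℂ) * (x - u) ^ 2 / 2) = (x - u) * 0 * Complex.I - v * (x - u) ^ 2 / 2 by ring,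
      ← this]
    refine integral_congr_ae (ae_of_all _ fun ω => ?_)
    simp only
    congr 1; ring
  · refine Integrable.of_bound (C := 2 * (g 0).re) ?_ (ae_of_all _ fun p => ?_)
    · exact (by fun_prop : Continuous (Function.uncurry fun ω u : ℝ =>
        Complex.exp (ω * (x - u) * Complex.I) * g u)).aestronglyMeasurable
    · rw [Function.uncurry, norm_mul, Complex.norm_exp]
      simpa using hg.norm_le p.2

/-- `g`, cut off at scale `s` and smoothed at scale `1 / s`. -/
lemma integral_gaussian_eq (g : ℝ → ℂ) {s : ℝ≥0} (hs : 0 < s) (x : ℝ) :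
    ∫ u, Complex.exp (-(((s ^ 2 : ℝ≥0) : ℂ) * (x - u) ^ 2 / 2)) * g u ∂(gaussianReal 0 (s ^ 2)) =
      ((s : ℂ) ^ 2)⁻¹ * ∫ w : ℝ, Complex.exp (-((x + w / s) ^ 2 / (2 * s ^ 2))) * g (x + w / s)
        ∂(gaussianReal 0 1) := by
  have hs' : (s : ℝ) ≠ 0 := by exact_mod_cast hs.ne'
  have hsC : (s : ℂ) ≠ 0 := by exact_mod_cast hs'
  rw [integral_gaussianReal_eq_integral_smul (by positivity),
    integral_gaussianReal_eq_integral_smul one_ne_zero]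
  have h1 := Measure.integral_comp_div (fun w : ℝ => gaussianPDFReal 0 (s ^ 2) (x + w) •
    (Complex.exp (-(((s ^ 2 : ℝ≥0) : ℂ) * (x - ((x + w : ℝ) : ℂ)) ^ 2 / 2)) * g (x + w))) (s : ℝ)
  rw [integral_add_left_eq_self (fun w : ℝ => gaussianPDFReal 0 (s ^ 2) w •
    (Complex.exp (-(((s ^ 2 : ℝ≥0) : ℂ) * (x - (w : ℂ)) ^ 2 / 2)) * g w)) x] at h1
  have h2 (I J : ℂ) (h : J = |(s : ℝ)| • I) : I = (s : ℂ)⁻¹ * J := by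
    rw [h, abs_of_nonneg s.coe_nonneg, Complex.real_smul]
    field_simp
  rw [h2 _ _ h1, ← integral_const_mul, ← integral_const_mul]
  refine integral_congr_ae (ae_of_all _ fun w => ?_)
  simp only [Complex.real_smul, gaussianPDFReal]
  have h3 : √(2 * Real.pi * ((s ^ 2 : ℝ≥0) : ℝ)) = √(2 * Real.pi * ((1 : ℝ≥0) : ℝ)) * s := by
    push_cast
    rw [mul_one, Real.sqrt_mul (by positivity), Real.sqrt_sq s.coe_nonneg]
  rw [h3]
  push_cast
  -- With `u = x + w / s` the two Gaussians exchange roles: the smoothing factor becomes the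
  -- standard normal density in `w`, the old density becomes the cut-off.
  have e1 : Complex.exp (-(x + w / s - 0) ^ 2 / (2 * (s : ℂ) ^ 2)) *
      Complex.exp (-((s : ℂ) ^ 2 * (x - (x + w / s)) ^ 2 / 2)) =
      Complex.exp (-(w - 0) ^ 2 / (2 * 1)) *
      Complex.exp (-((x + w / s) ^ 2 / (2 * (s : ℂ) ^ 2))) := by
    rw [← Complex.exp_add, ← Complex.exp_add]
    congr 1
    field_simp
    ring
  rw [mul_inv]
  linear_combination (g (x + w / s) * (s : ℂ)⁻¹ ^ 2 * ((√(2 * Real.pi * 1) : ℝ) : ℂ)⁻¹) * e1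

lemma tendsto_gaussian_smoothing (hg : IsPositiveDefinite g) (hc : Continuous g) (x : ℝ) :
    Tendsto (fun n : ℕ => ∫ w : ℝ, Complex.exp (-((x + w / (n : ℝ)) ^ 2 / (2 * (n : ℝ) ^ 2))) *
      g (x + w / (n : ℝ)) ∂(gaussianReal 0 1)) atTop (𝓝 (g x)) := by
  have : g x = ∫ w : ℝ, g x ∂(gaussianReal 0 1) := by simp
  rw [this]
  refine tendsto_integral_of_dominated_convergence (fun _ => 2 * (g 0).re) ?_
    (integrable_const _) ?_ ?_
  · exact fun n => (by fun_prop : Continuous fun w : ℝ =>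
      Complex.exp (-((x + w / (n : ℝ)) ^ 2 / (2 * (n : ℝ) ^ 2))) *
      g (x + w / (n : ℝ))).aestronglyMeasurable
  · refine fun n => ae_of_all _ fun w => ?_
    rw [norm_mul]
    have h : ‖Complex.exp (-((x + w / (n : ℝ)) ^ 2 / (2 * (n : ℝ) ^ 2)))‖ ≤ 1 := by
      rw [show (-((x + w / (n : ℝ)) ^ 2 / (2 * (n : ℝ) ^ 2)) : ℂ) =
        ((-((x + w / (n : ℝ)) ^ 2 / (2 * (n : ℝ) ^ 2)) : ℝ) : ℂ) by push_cast; rfl,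
        Complex.norm_exp_ofReal, Real.exp_le_one_iff, neg_nonpos]
      positivity
    exact (mul_le_of_le_one_left (norm_nonneg _) h).trans (hg.norm_le _)
  · refine ae_of_all _ fun w => ?_
    have h1 : Tendsto (fun n : ℕ => x + w / (n : ℝ)) atTop (𝓝 x) := by
      simpa using tendsto_const_nhds.add (tendsto_const_div_atTop_nhds_zero_nat w)
    have h2 : Tendsto (fun n : ℕ => (-((x + w / (n : ℝ)) ^ 2 / (2 * (n : ℝ) ^ 2)) : ℝ)) atTop
        (𝓝 0) := by
      have h3 : Tendsto (fun n : ℕ => (2 * (n : ℝ) ^ 2)) atTop atTop :=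
        Tendsto.const_mul_atTop (by norm_num)
          ((tendsto_pow_atTop two_ne_zero).comp tendsto_natCast_atTop_atTop)
      simpa using ((h1.pow 2).div_atTop h3).neg
    have h4 := ((Complex.continuous_exp.comp Complex.continuous_ofReal).tendsto 0).comp h2
    have h5 := h4.mul ((hc.tendsto x).comp h1)
    simp at h5
    refine h5.congr fun n => ?_
    simp

/-- **Bochner's theorem** on the real line. -/
theorem exists_charFun_eq (hg : IsPositiveDefinite g) (hc : Continuous g) :
    ∃ ν : Measure ℝ, IsFiniteMeasure ν ∧ ∀ t, charFun ν t = g t := by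
  rcases hg.zero_re.eq_or_lt with h0 | h0
  · refine ⟨0, inferInstance, fun t => ?_⟩
    have := hg.norm_le t
    rw [← h0, mul_zero, norm_le_zero_iff] at this
    simp [this]
  let κ (n : ℕ) : Measure ℝ := (gaussianReal 0 ((n : ℝ≥0) ^ 2)).withDensity fun ω =>
    ENNReal.ofReal (∫ u, Complex.exp (-(ω * u) * Complex.I) * g u
      ∂(gaussianReal 0 ((n : ℝ≥0) ^ 2))).re
  have hfin (n : ℕ) : IsFiniteMeasure (κ n) := by
    refine isFiniteMeasure_withDensity_ofReal ?_
    refine Integrable.hasFiniteIntegral ?_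
    refine Integrable.of_bound (C := 2 * (g 0).re) ?_ (ae_of_all _ fun ω => ?_)
    · exact (Complex.continuous_re.comp
        (hg.continuous_gaussianTransform hc _)).aestronglyMeasurable
    · refine (Complex.abs_re_le_norm _).trans ?_
      refine (norm_integral_le_of_norm_le_const (C := 2 * (g 0).re)
        (ae_of_all _ fun u => ?_)).trans (by simp)
      rw [norm_mul, Complex.norm_exp]
      simpa using hg.norm_le u
  -- The factor `n²` undoes the `(s²)⁻¹` of `integral_gaussian_eq` at `s = n`; at `t = 0` it gives
  -- the masses by which `κ n` is normalised below.
  have hlim (t : ℝ) : Tendsto (fun n : ℕ => (n : ℂ) ^ 2 * charFun (κ n) t) atTop (𝓝 (g t)) := by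
    refine (hg.tendsto_gaussian_smoothing hc t).congr' ?_
    filter_upwards [eventually_gt_atTop 0] with n hn
    have hn' : (n : ℂ) ≠ 0 := by exact_mod_cast hn.ne'
    have h1 := hg.charFun_withDensity_gaussianTransform hc ((n : ℝ≥0) ^ 2) t
    have h2 := integral_gaussian_eq g (s := (n : ℝ≥0)) (by exact_mod_cast hn) t
    rw [h2] at h1
    simp only [κ]
    rw [h1]
    push_cast
    field_simp
  have hmass := hlim 0
  simp_rw [charFun_zero] at hmass
  have hg0 : g 0 ≠ 0 := fun h => by simp [h] at h0
  have hev : ∀ᶠ n in atTop, κ n ≠ 0 := by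
    filter_upwards [hmass.eventually_ne hg0] with n hn hκ
    simp [hκ] at hn
  obtain ⟨N, hN⟩ := eventually_atTop.1 hev
  have hprob (n : ℕ) : IsProbabilityMeasure ((κ (n + N) univ)⁻¹ • κ (n + N)) := by
    have : NeZero (κ (n + N)) := ⟨hN _ (by omega)⟩
    infer_instance
  obtain ⟨ν, hν, hν'⟩ := exists_charFun_eq_of_tendsto
    (μ := fun n => (κ (n + N) univ)⁻¹ • κ (n + N)) (f := fun t => g t / g 0)
    (by fun_prop) fun t => by
      have h1 := ((hlim t).div hmass hg0).comp (tendsto_add_atTop_nat N)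
      refine h1.congr' ?_
      filter_upwards [eventually_gt_atTop 0] with n hn
      have hn' : ((n + N : ℕ) : ℂ) ≠ 0 := by
        exact_mod_cast (show n + N ≠ 0 by omega)
      simp only [Function.comp, charFun_apply_real, integral_smul_measure, Pi.div_apply]
      rw [mul_div_mul_left _ _ (pow_ne_zero _ hn'), ENNReal.toReal_inv, Complex.real_smul,
        div_eq_inv_mul]
      simp [Measure.real]
  refine ⟨ENNReal.ofReal (g 0).re • ν, ?_, fun t => ?_⟩
  · exact Measure.smul_finite _ (by simp)
  · have h1 := hν' t
    rw [charFun_apply_real] at h1 ⊢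
    rw [integral_smul_measure, h1, ENNReal.toReal_ofReal h0.le, Complex.real_smul]
    have : (((g 0).re : ℝ) : ℂ) = g 0 := Complex.ext (by simp) (by simp [hg.zero_im])
    rw [this]
    field_simp

end IsPositiveDefinite

/-! ### States -/

namespace IsState

variable {A : Type*} [Ring A] [StarRing A] [Algebra ℂ A] [StarModule ℂ A] {ρ : A →ₗ[ℂ] ℂ}

/-- Polarisation: `ρ` is real on the squares of `1 + a` and `1 + i a`. -/
lemma map_star (hρ : IsState ρ) (a : A) : ρ (star a) = conj (ρ a) := by
  have h1 := (hρ.2 (1 + a)).2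
  have h2 := (hρ.2 (1 + Complex.I • a)).2
  have h3 := (hρ.2 a).2
  have e1 : star (1 + a) * (1 + a) = 1 + a + star a + star a * a := by
    simp only [star_add, star_one]; noncomm_ring
  have e2 : star (1 + Complex.I • a) * (1 + Complex.I • a) =
      1 + Complex.I • a - Complex.I • star a + star a * a := by
    have h : Complex.I • star a * Complex.I • a = -(star a * a) := by
      rw [smul_mul_smul_comm, Complex.I_mul_I, neg_smul, one_smul]
    simp only [star_add, star_one, star_smul, Complex.star_def, Complex.conj_I, neg_smul,
      add_mul, mul_add, neg_mul, h, one_mul, mul_one]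
    abel
  rw [e1] at h1
  rw [e2] at h2
  simp [hρ.1] at h1 h2
  apply Complex.ext
  · simp; linarith
  · simp; linarith

/-- A weak Cauchy–Schwarz inequality, from positivity at `a + w b` with `w = ±1, ±i`. Only
boundedness of correlations is needed from it. -/
lemma norm_star_mul_le (hρ : IsState ρ) (a b : A) :
    ‖ρ (star a * b)‖ ≤ (ρ (star a * a)).re + (ρ (star b * b)).re := by
  have hba : ρ (star b * a) = conj (ρ (star a * b)) := by
    rw [← hρ.map_star]; simp
  have key (w : ℂ) (hw : conj w * w = 1) :
      0 ≤ (ρ (star a * a)).re + (ρ (star b * b)).re + 2 * (w * ρ (star a * b)).re := by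
    have h := (hρ.2 (a + w • b)).1
    have e : star (a + w • b) * (a + w • b) =
        star a * a + w • (star a * b) + conj w • (star b * a) + (conj w * w) • (star b * b) := by
      simp only [star_add, star_smul, Complex.star_def, add_mul, mul_add, smul_mul_assoc,
        mul_smul_comm]
      rw [smul_add, smul_smul, mul_comm w]
      abel
    rw [e, hw] at h
    simp [hba] at h ⊢
    linarith
  have h1 := key 1 (by simp)
  have h2 := key (-1) (by simp)
  have h3 := key Complex.I (by simp)
  have h4 := key (-Complex.I) (by simp)
  simp at h1 h2 h3 h4
  refine (Complex.norm_le_abs_re_add_abs_im _).trans ?_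
  have ha : |(ρ (star a * b)).re| ≤ ((ρ (star a * a)).re + (ρ (star b * b)).re) / 2 :=
    abs_le.2 ⟨by linarith, by linarith⟩
  have hb : |(ρ (star a * b)).im| ≤ ((ρ (star a * a)).re + (ρ (star b * b)).re) / 2 :=
    abs_le.2 ⟨by linarith, by linarith⟩
  linarith

end IsState

/-! ### The time Fourier transform of test functions -/

/-- `∫ φ(t) e^{iωt} dt`. -/
def timeFT (φ : 𝓢(ℝ, ℝ)) (ω : ℝ) : ℂ := ∫ t : ℝ, (φ t : ℂ) * Complex.exp (ω * t * Complex.I)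

lemma norm_exp_mul_I (ω t : ℝ) : ‖Complex.exp (ω * t * Complex.I)‖ = 1 := by
  simp [Complex.norm_exp]

lemma integrable_ofReal_mul_exp {φ : ℝ → ℝ} (hφ : Integrable φ) (ω : ℝ) :
    Integrable fun t : ℝ => (φ t : ℂ) * Complex.exp (ω * t * Complex.I) :=
  hφ.ofReal.mul_bdd (c := 1) (by fun_prop) (ae_of_all _ fun t => (norm_exp_mul_I ω t).le)

lemma timeFT_deriv (φ : 𝓢(ℝ, ℝ)) (ω : ℝ) :
    timeFT (SchwartzMap.derivCLM ℝ ℝ φ) ω = -(Complex.I * ω) * timeFT φ ω := by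
  have h := integral_mul_deriv_eq_deriv_mul_of_integrable
    (u := fun t : ℝ => Complex.exp (ω * t * Complex.I))
    (u' := fun t : ℝ => Complex.exp (ω * t * Complex.I) * (ω * Complex.I))
    (v := fun t : ℝ => (φ t : ℂ)) (v' := fun t : ℝ => ((deriv φ t : ℝ) : ℂ))
    (fun t _ => by
      have h1 : HasDerivAt (fun t : ℝ => (ω * t * Complex.I : ℂ)) (ω * Complex.I) t := by
        simpa using ((Complex.ofRealCLM.hasDerivAt (x := t)).const_mul (ω : ℂ)).mul_const Complex.I
      exact h1.cexp)
    (fun t _ => (φ.differentiableAt.hasDerivAt (x := t)).ofReal_comp)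
    (((integrable_ofReal_mul_exp (SchwartzMap.derivCLM ℝ ℝ φ).integrable ω)).congr
      (ae_of_all _ fun t => by simp [mul_comm]))
    (((integrable_ofReal_mul_exp φ.integrable ω).mul_const (ω * Complex.I)).congr
      (ae_of_all _ fun t => by simp only [Pi.mul_apply]; ring))
    ((integrable_ofReal_mul_exp φ.integrable ω).congr
      (ae_of_all _ fun t => by simp [mul_comm]))
  calc timeFT (SchwartzMap.derivCLM ℝ ℝ φ) ω
      = ∫ t : ℝ, Complex.exp (ω * t * Complex.I) * ((deriv φ t : ℝ) : ℂ) := by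
        rw [timeFT]
        exact integral_congr_ae (ae_of_all _ fun t => by simp [mul_comm])
    _ = _ := by
        rw [h, timeFT, ← integral_neg, ← integral_const_mul]
        exact integral_congr_ae (ae_of_all _ fun t => by simp only; ring)

/-! ### Convolution with the memory function. -/

section Memory

variable {k ψ : ℝ → ℂ} {μ : Measure ℝ} [SFinite μ]

/-- The shear `(s, t) ↦ (s, s + t)` preserves the product measure. -/
lemma integrable_memory (hk : Integrable k μ) (hψ : Integrable ψ) :
    Integrable (fun p : ℝ × ℝ => k p.1 * ψ (p.2 + p.1)) (μ.prod volume) := by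
  have h := (measurePreserving_prod_add μ (volume : Measure ℝ)).integrable_comp_of_integrable
    (hk.mul_prod hψ)
  refine h.congr (ae_of_all _ fun p => ?_)
  simp [Function.comp, add_comm]

lemma integrable_integral_memory (hk : Integrable k μ) (hψ : Integrable ψ) :
    Integrable fun t => ∫ s, k s * ψ (t + s) ∂μ :=
  (integrable_memory hk hψ).integral_prod_right

lemma integral_integral_memory (hk : Integrable k μ) (hψ : Integrable ψ) :
    ∫ t, ∫ s, k s * ψ (t + s) ∂μ = (∫ s, k s ∂μ) * ∫ t, ψ t := by
  rw [← integral_integral_swap (f := fun s t => k s * ψ (t + s)) (integrable_memory hk hψ),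
    ← integral_mul_const]
  refine integral_congr_ae (ae_of_all _ fun s => ?_)
  simp only
  rw [integral_const_mul, integral_add_right_eq_self]

end Memory

/-! ### The equation of motion of the circular components -/

namespace System

variable (S : System)

/-- The transposed operator of the Langevin equation, acting on the circular component
`x + iσy`, `σ = ±1`. -/
def circularAdjoint (σ : ℝ) (φ : 𝓢(ℝ, ℝ)) (t : ℝ) : ℂ :=
  (S.adjointOp φ t : ℂ) - σ * Complex.I * (S.e * S.B / S.c : ℝ) * ((deriv φ t : ℝ) : ℂ)

/-- The symbol of the Langevin equation of the circular component `x + iσy`, `σ = ±1`. -/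
def symbol (σ ω : ℝ) : ℂ :=
  S.m * (S.ω₀ ^ 2 - ω ^ 2) + Complex.I * ω * S.frictionFT ω - σ * (S.e * S.B / S.c : ℝ) * ω

lemma adjointOp_ofReal (φ : 𝓢(ℝ, ℝ)) (t : ℝ) :
    (S.adjointOp φ t : ℂ) =
      S.m * ((SchwartzMap.derivCLM ℝ ℝ (SchwartzMap.derivCLM ℝ ℝ φ) t : ℝ) : ℂ)
        - (S.μ₀ * ((deriv φ t : ℝ) : ℂ)
          + ∫ s in Ioi (0 : ℝ), (S.k s : ℂ) * ((deriv φ (t + s) : ℝ) : ℂ))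
        + S.m * S.ω₀ ^ 2 * (φ t : ℂ) := by
  rw [adjointOp]
  have h : iteratedDeriv 2 φ t =
      SchwartzMap.derivCLM ℝ ℝ (SchwartzMap.derivCLM ℝ ℝ φ) t := by
    rw [SchwartzMap.derivCLM_apply, iteratedDeriv_succ, iteratedDeriv_one]
    congr 1
  rw [h]
  push_cast
  congr 4
  rw [← integral_complex_ofReal]
  push_cast
  rfl

lemma k_integrable_ofReal : Integrable (fun s => (S.k s : ℂ)) (volume.restrict (Ioi 0)) :=
  S.k_integrable.ofReal

lemma integrable_deriv (φ : 𝓢(ℝ, ℝ)) : Integrable fun t => ((deriv φ t : ℝ) : ℂ) :=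
  (SchwartzMap.derivCLM ℝ ℝ φ).integrable.ofReal

lemma integrable_adjointOp (φ : 𝓢(ℝ, ℝ)) : Integrable fun t => (S.adjointOp φ t : ℂ) := by
  simp_rw [S.adjointOp_ofReal]
  exact ((((SchwartzMap.derivCLM ℝ ℝ
    (SchwartzMap.derivCLM ℝ ℝ φ)).integrable (μ := volume)).ofReal.const_mul _).sub
    (((integrable_deriv φ).const_mul _).add
      (integrable_integral_memory S.k_integrable_ofReal (integrable_deriv φ)))).add
    (φ.integrable.ofReal.const_mul _)

lemma integrable_circularAdjoint (σ : ℝ) (φ : 𝓢(ℝ, ℝ)) : Integrable (S.circularAdjoint σ φ) :=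
  (S.integrable_adjointOp φ).sub ((integrable_deriv φ).const_mul _)

lemma circularAdjoint_FT (σ : ℝ) (φ : 𝓢(ℝ, ℝ)) (ω : ℝ) :
    ∫ t : ℝ, S.circularAdjoint σ φ t * Complex.exp (ω * t * Complex.I) =
      S.symbol σ ω * timeFT φ ω := by
  have i0 := integrable_ofReal_mul_exp φ.integrable ω
  have i1 := integrable_ofReal_mul_exp (SchwartzMap.derivCLM ℝ ℝ φ).integrable ω
  have i2 := integrable_ofReal_mul_exp
    (SchwartzMap.derivCLM ℝ ℝ (SchwartzMap.derivCLM ℝ ℝ φ)).integrable ω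
  have hK : Integrable (fun s : ℝ => (S.k s : ℂ) * Complex.exp (-(Complex.I * ω * s)))
      (volume.restrict (Ioi 0)) :=
    S.k_integrable_ofReal.mul_bdd (c := 1) (by fun_prop)
      (ae_of_all _ fun t => by simp [Complex.norm_exp])
  have i3 := integrable_integral_memory hK i1
  have e3 := integral_integral_memory hK i1
  have d1 := timeFT_deriv φ ω
  have d2 := timeFT_deriv (SchwartzMap.derivCLM ℝ ℝ φ) ω
  rw [d1] at d2
  simp only [timeFT] at d1 d2
  rw [d1] at e3
  have hpt (t : ℝ) : S.circularAdjoint σ φ t * Complex.exp (ω * t * Complex.I) =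
      S.m * (((SchwartzMap.derivCLM ℝ ℝ (SchwartzMap.derivCLM ℝ ℝ φ) t : ℝ) : ℂ) *
        Complex.exp (ω * t * Complex.I))
      - (S.μ₀ + σ * Complex.I * (S.e * S.B / S.c : ℝ)) *
        (((SchwartzMap.derivCLM ℝ ℝ φ t : ℝ) : ℂ) * Complex.exp (ω * t * Complex.I))
      - (∫ s in Ioi (0 : ℝ), (S.k s : ℂ) * Complex.exp (-(Complex.I * ω * s)) *
        (((SchwartzMap.derivCLM ℝ ℝ φ (t + s) : ℝ) : ℂ) *
          Complex.exp (ω * (t + s : ℝ) * Complex.I)))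
      + S.m * S.ω₀ ^ 2 * ((φ t : ℂ) * Complex.exp (ω * t * Complex.I)) := by
    have : (∫ s in Ioi (0 : ℝ), (S.k s : ℂ) * Complex.exp (-(Complex.I * ω * s)) *
        (((SchwartzMap.derivCLM ℝ ℝ φ (t + s) : ℝ) : ℂ) *
          Complex.exp (ω * (t + s : ℝ) * Complex.I))) =
        (∫ s in Ioi (0 : ℝ), (S.k s : ℂ) * ((deriv φ (t + s) : ℝ) : ℂ)) *
          Complex.exp (ω * t * Complex.I) := by
      rw [← integral_mul_const]
      refine integral_congr_ae (ae_of_all _ fun s => ?_)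
      have : Complex.exp (ω * (t + s : ℝ) * Complex.I) * Complex.exp (-(Complex.I * ω * s)) =
          Complex.exp (ω * t * Complex.I) := by
        rw [← Complex.exp_add]; congr 1; push_cast; ring
      simp only [SchwartzMap.derivCLM_apply]
      rw [← this]
      ring
    rw [this, circularAdjoint, adjointOp_ofReal, SchwartzMap.derivCLM_apply ℝ φ t]
    ring
  simp_rw [hpt]
  rw [integral_add, integral_sub, integral_sub, integral_const_mul, integral_const_mul,
    integral_const_mul, e3, d1, d2, symbol, frictionFT, timeFT]
  · ring_nf
    simp only [Complex.I_sq]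
    ring
  · exact i2.const_mul _
  · exact i1.const_mul _
  · exact (i2.const_mul _).sub (i1.const_mul _)
  · exact i3
  · exact ((i2.const_mul _).sub (i1.const_mul _)).sub i3
  · exact i0.const_mul _

/-- The product is the Fourier transform of an integrable function. Its boundedness makes it
integrable against any finite measure, before anything is known about the decay of `ν`. -/
lemma norm_symbol_mul_timeFT_le (σ : ℝ) (φ : 𝓢(ℝ, ℝ)) (ω : ℝ) :
    ‖S.symbol σ ω * timeFT φ ω‖ ≤ ∫ t, ‖S.circularAdjoint σ φ t‖ := by
  rw [← S.circularAdjoint_FT]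
  refine (norm_integral_le_integral_norm _).trans (le_of_eq ?_)
  refine integral_congr_ae (ae_of_all _ fun t => ?_)
  simp only [norm_mul, norm_exp_mul_I, mul_one]

lemma continuous_symbol_mul_timeFT (σ : ℝ) (φ : 𝓢(ℝ, ℝ)) :
    Continuous fun ω => S.symbol σ ω * timeFT φ ω := by
  simp_rw [← S.circularAdjoint_FT]
  refine continuous_of_dominated (bound := fun t => ‖S.circularAdjoint σ φ t‖) ?_ ?_
    (S.integrable_circularAdjoint σ φ).norm ?_
  · exact fun ω => (S.integrable_circularAdjoint σ φ).1.mul (by fun_prop)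
  · exact fun ω => ae_of_all _ fun t => by rw [norm_mul, norm_exp_mul_I, mul_one]
  · exact ae_of_all _ fun t => by fun_prop

end System

/-! ### Circular components of the steady state -/

section Circular

variable {A : Type*} [Ring A] [StarRing A] [Algebra ℂ A]

/-- The circular component `F_x + iσF_y` of a pair of operator-valued functions. -/
def circular (σ : ℝ) {X : Type*} (F : Fin 2 → X → A) (x : X) : A :=
  F 0 x + (σ * Complex.I : ℂ) • F 1 x

variable {S : System} {ρ : A →ₗ[ℂ] ℂ} {f : Fin 2 → 𝓢(ℝ, ℝ) →ₗ[ℝ] A} {r : Fin 2 → ℝ → A}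

/-- The antisymmetric cross-correlation is the only part odd in `σ`, so it can be read off from the
difference of `σ = 1` and `σ = -1`. -/
lemma star_circular_mul [StarModule ℂ A] {X : Type*} {F : Fin 2 → X → A}
    (hF : ∀ α x, IsSelfAdjoint (F α x)) (σ : ℝ) (x y : X) :
    ρ (star (circular σ F x) * circular σ F y) =
      ρ (F 0 x * F 0 y) + σ ^ 2 * ρ (F 1 x * F 1 y) +
        σ * Complex.I * (ρ (F 0 x * F 1 y) - ρ (F 1 x * F 0 y)) := by
  have h0 := (hF 0 x).star_eq
  have h1 := (hF 1 x).star_eq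
  simp only [circular, star_add, star_smul, h0, h1, Complex.star_def, map_mul,
    Complex.conj_ofReal, Complex.conj_I, add_mul, mul_add, smul_mul_assoc, mul_smul_comm, map_add,
    map_smul, smul_eq_mul]
  ring_nf
  simp only [Complex.I_sq]
  ring

namespace IsSteadyState

lemma continuous_circular (hr : IsSteadyState S ρ f r) (σ : ℝ) (a : A) :
    Continuous fun t => ρ (a * circular σ r t) := by
  simp only [circular, mul_add, mul_smul_comm, map_add, map_smul, smul_eq_mul]
  exact (hr.continuous 0 a).add ((hr.continuous 1 a).const_mul _)

variable [StarModule ℂ A]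

/-- Stationarity fixes the variance of the position, so the bound is uniform in `t`. -/
lemma norm_le (hρ : IsState ρ) (hr : IsSteadyState S ρ f r) (α : Fin 2) (a : A) (t : ℝ) :
    ‖ρ (a * r α t)‖ ≤ (ρ (a * star a)).re + (ρ (r α 0 * r α 0)).re := by
  have h := hρ.norm_star_mul_le (star a) (r α t)
  have h1 := hr.stationary α α 0 0 t
  rw [zero_add] at h1
  rwa [star_star, (hr.selfAdjoint α t).star_eq, h1] at h

lemma integrable_mul (hρ : IsState ρ) (hr : IsSteadyState S ρ f r) {h : ℝ → ℂ}
    (hh : Integrable h) (α : Fin 2) (a : A) : Integrable fun t => h t * ρ (a * r α t) :=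
  hh.mul_bdd (hr.continuous α a).aestronglyMeasurable (ae_of_all _ fun t => hr.norm_le hρ α a t)

/-- The Langevin equation of the circular components. -/
lemma langevin_circular (hρ : IsState ρ) (hr : IsSteadyState S ρ f r) {σ : ℝ} (hσ : σ ^ 2 = 1)
    (φ : 𝓢(ℝ, ℝ)) (a : A) :
    ∫ t : ℝ, S.circularAdjoint σ φ t * ρ (a * circular σ r t) =
      ρ (a * circular σ (fun α => f α) φ) := by
  have hx := hr.langevin_x φ a
  have hy := hr.langevin_y φ a
  have hσ' : (σ : ℂ) ^ 2 = 1 := by exact_mod_cast hσ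
  have i0 := fun α => hr.integrable_mul hρ (S.integrable_adjointOp φ) α a
  have i1 := fun α => hr.integrable_mul hρ (System.integrable_deriv φ) α a
  have e (t : ℝ) : S.circularAdjoint σ φ t * ρ (a * circular σ r t) =
      ((S.adjointOp φ t : ℂ) * ρ (a * r 0 t)
        + (S.e * S.B / S.c : ℝ) * (((deriv φ t : ℝ) : ℂ) * ρ (a * r 1 t)))
      + (σ * Complex.I) * ((S.adjointOp φ t : ℂ) * ρ (a * r 1 t)
        - (S.e * S.B / S.c : ℝ) * (((deriv φ t : ℝ) : ℂ) * ρ (a * r 0 t))) := by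
    simp only [circular, mul_add, mul_smul_comm, map_add, map_smul, System.circularAdjoint,
      smul_eq_mul]
    linear_combination (-(S.e * S.B / S.c : ℝ) * ((deriv φ t : ℝ) : ℂ) * ρ (a * r 1 t)) *
      (Complex.I ^ 2 * hσ' + Complex.I_sq)
  simp_rw [e]
  rw [integral_add, integral_const_mul, integral_add, integral_sub, integral_const_mul,
    integral_const_mul, hx, hy]
  · simp [circular, mul_add]
  · exact i0 1
  · exact (i1 0).const_mul _
  · exact i0 0
  · exact (i1 1).const_mul _
  · exact (i0 0).add ((i1 1).const_mul _)
  · exact ((i0 1).sub ((i1 0).const_mul _)).const_mul _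

lemma circular_stationary (hr : IsSteadyState S ρ f r) (σ s t : ℝ) :
    ρ (star (circular σ r s) * circular σ r t) =
      ρ (star (circular σ r 0) * circular σ r (t - s)) := by
  have h := fun α β => hr.stationary α β 0 (t - s) s
  simp only [zero_add, sub_add_cancel] at h
  rw [star_circular_mul hr.selfAdjoint, star_circular_mul hr.selfAdjoint]
  simp only [h]

/-- By stationarity the quadratic form is `ρ (Z* Z)` with `Z = ∑ c_i z_σ(t_i)`. -/
lemma circular_isPositiveDefinite (hρ : IsState ρ) (hr : IsSteadyState S ρ f r) (σ : ℝ) :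
    IsPositiveDefinite fun u => ρ (star (circular σ r 0) * circular σ r u) := by
  intro n t c
  have h := hρ.2 (∑ i, c i • circular σ r (t i))
  have e : ∑ i, ∑ j, conj (c i) * c j * ρ (star (circular σ r 0) * circular σ r (t j - t i)) =
      ρ (star (∑ i, c i • circular σ r (t i)) * ∑ i, c i • circular σ r (t i)) := by
    simp only [← hr.circular_stationary σ, star_sum, star_smul, Finset.sum_mul_sum, map_sum,
      smul_mul_assoc, mul_smul_comm, map_smul, smul_eq_mul, Complex.star_def]
    refine Finset.sum_congr rfl fun i _ => Finset.sum_congr rfl fun j _ => ?_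
    ring
  simp only [e]
  exact h

/-- The spectral measure of a circular component. -/
lemma exists_spectralMeasure (hρ : IsState ρ) (hr : IsSteadyState S ρ f r) {σ : ℝ}
    (hσ : σ ^ 2 = 1) :
    ∃ ν : Measure ℝ, IsFiniteMeasure ν ∧
      (∀ u, ρ (star (circular σ r 0) * circular σ r u) = charFun ν u) ∧
      ∀ φ ψ : 𝓢(ℝ, ℝ),
        ρ (star (circular σ (fun α => f α) ψ) * circular σ (fun α => f α) φ) =
          ∫ ω, S.symbol σ ω * timeFT φ ω * conj (S.symbol σ ω * timeFT ψ ω) ∂ν := by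
  obtain ⟨ν, hν, hchar⟩ := (hr.circular_isPositiveDefinite hρ σ).exists_charFun_eq
    (hr.continuous_circular σ _)
  refine ⟨ν, hν, fun u => (hchar u).symm, fun φ ψ => ?_⟩
  have hfub (φ : 𝓢(ℝ, ℝ)) {h : ℝ → ℂ} (hh : Integrable h ν) :
      ∫ t : ℝ, S.circularAdjoint σ φ t * ∫ ω, Complex.exp (ω * t * Complex.I) * h ω ∂ν =
        ∫ ω, S.symbol σ ω * timeFT φ ω * h ω ∂ν := by
    simp_rw [← integral_const_mul]
    rw [integral_integral_swap]
    · refine integral_congr_ae (ae_of_all _ fun ω => ?_)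
      simp only
      rw [← S.circularAdjoint_FT, ← integral_mul_const]
      refine integral_congr_ae (ae_of_all _ fun t => ?_)
      simp only; ring
    · have h1 := (S.integrable_circularAdjoint σ φ).mul_prod hh
      have h2 := h1.mul_bdd (c := 1) (g := fun p : ℝ × ℝ => Complex.exp (p.2 * p.1 * Complex.I))
        (by fun_prop) (ae_of_all _ fun p => (norm_exp_mul_I _ _).le)
      refine h2.congr (ae_of_all _ fun p => ?_)
      simp only [Function.uncurry]; ring
  have hbdd : Integrable (fun ω => S.symbol σ ω * timeFT ψ ω) ν :=
    Integrable.of_bound (S.continuous_symbol_mul_timeFT σ ψ).aestronglyMeasurable _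
      (ae_of_all _ fun ω => S.norm_symbol_mul_timeFT_le σ ψ ω)
  -- The equation of motion applies only to the right factor. Conjugation brings the force there,
  -- giving the force-position correlation; a second use then treats the other factor.
  have hpos (t : ℝ) : ρ (star (circular σ (fun α => f α) ψ) * circular σ r t) =
      ∫ ω, Complex.exp (ω * t * Complex.I) * conj (S.symbol σ ω * timeFT ψ ω) ∂ν := by
    have h1 : ρ (star (circular σ (fun α => f α) ψ) * circular σ r t) =
        conj (ρ (star (circular σ r t) * circular σ (fun α => f α) ψ)) := by
      rw [← hρ.map_star]; simp
    have h2 (s : ℝ) : ρ (star (circular σ r t) * circular σ r s) =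
        ∫ ω, Complex.exp (ω * s * Complex.I) * Complex.exp (-(ω * t * Complex.I)) ∂ν := by
      rw [hr.circular_stationary σ, ← hchar, charFun_apply_real]
      refine integral_congr_ae (ae_of_all _ fun ω => ?_)
      simp only
      rw [← Complex.exp_add]
      congr 1; push_cast; ring
    rw [h1, ← hr.langevin_circular hρ hσ]
    simp_rw [h2]
    rw [hfub ψ, ← integral_conj]
    · refine integral_congr_ae (ae_of_all _ fun ω => ?_)
      simp only [map_mul, ← Complex.exp_conj, map_neg, Complex.conj_ofReal, Complex.conj_I]
      rw [show -((ω : ℂ) * t * -Complex.I) = ω * t * Complex.I by ring]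
      ring
    · refine Integrable.of_bound (C := 1) (by fun_prop) (ae_of_all _ fun ω => ?_)
      simp [Complex.norm_exp]
  rw [← hr.langevin_circular hρ hσ]
  simp_rw [hpos]
  exact hfub φ (Complex.conjLIE.toContinuousLinearEquiv.integrable_comp_iff.2 hbdd)

end IsSteadyState

end Circular

/-! ### Gaussian test functions -/

lemma exists_abs_aeval_mul_gaussian_le (p : Polynomial ℤ) :
    ∃ C : ℝ, ∀ x : ℝ, |Polynomial.aeval x p| * Real.exp (-(x ^ 2 / 2)) ≤ C := by
  induction p using Polynomial.induction_on' with
  | add p q hp hq =>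
    obtain ⟨C, hC⟩ := hp
    obtain ⟨D, hD⟩ := hq
    refine ⟨C + D, fun x => ?_⟩
    have h := mul_le_mul_of_nonneg_right
      (abs_add_le (Polynomial.aeval x p) (Polynomial.aeval x q)) (Real.exp_pos (-(x ^ 2 / 2))).le
    rw [map_add]
    linarith [hC x, hD x]
  | monomial n a =>
    refine ⟨|(a : ℝ)| * (n.factorial * Real.exp (1 / 2)), fun x => ?_⟩
    have h1 := Real.pow_div_factorial_le_exp |x| (abs_nonneg x) n
    rw [div_le_iff₀ (by positivity)] at h1
    have h2 : Real.exp |x| * Real.exp (-(x ^ 2 / 2)) ≤ Real.exp (1 / 2) := by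
      rw [← Real.exp_add, Real.exp_le_exp]
      nlinarith [sq_nonneg (|x| - 1), sq_abs x]
    rw [Polynomial.aeval_monomial, abs_mul, abs_pow]
    simp only [eq_intCast]
    rw [mul_assoc]
    refine mul_le_mul_of_nonneg_left ?_ (abs_nonneg _)
    calc |x| ^ n * Real.exp (-(x ^ 2 / 2))
        ≤ Real.exp |x| * n.factorial * Real.exp (-(x ^ 2 / 2)) :=
          mul_le_mul_of_nonneg_right h1 (Real.exp_pos _).le
      _ = n.factorial * (Real.exp |x| * Real.exp (-(x ^ 2 / 2))) := by ring
      _ ≤ _ := mul_le_mul_of_nonneg_left h2 (by positivity)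

/-- The Gaussian `e^{-t²/2}` as a Schwartz function. -/
def gaussianTest : 𝓢(ℝ, ℝ) where
  toFun t := Real.exp (-(t ^ 2 / 2))
  smooth' := by fun_prop
  decay' k n := by
    obtain ⟨C, hC⟩ := exists_abs_aeval_mul_gaussian_le (Polynomial.X ^ k * Polynomial.hermite n)
    refine ⟨C, fun x => ?_⟩
    rw [norm_iteratedFDeriv_eq_norm_iteratedDeriv, iteratedDeriv_eq_iterate,
      Polynomial.deriv_gaussian_eq_hermite_mul_gaussian]
    have h := hC x
    simp only [norm_mul, norm_pow, norm_neg, norm_one, one_pow, one_mul, Real.norm_eq_abs,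
      Real.abs_exp]
    rw [map_mul, map_pow, Polynomial.aeval_X, abs_mul, abs_pow] at h
    linarith

lemma timeFT_gaussianTest (ω : ℝ) :
    timeFT gaussianTest ω = ((√(2 * Real.pi) * Real.exp (-(ω ^ 2 / 2)) : ℝ) : ℂ) := by
  have h := charFun_gaussianReal (μ := 0) (v := 1) ω
  rw [charFun_apply_real, integral_gaussianReal_eq_integral_smul one_ne_zero] at h
  have h1 : timeFT gaussianTest ω = (√(2 * Real.pi) : ℝ) *
      ∫ t : ℝ, gaussianPDFReal 0 1 t • Complex.exp (ω * t * Complex.I) := by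
    rw [timeFT, ← integral_const_mul]
    refine integral_congr_ae (ae_of_all _ fun t => ?_)
    have hpi : √(2 * Real.pi) ≠ 0 := by positivity
    simp only [gaussianPDFReal, Complex.real_smul, ← mul_assoc, ← Complex.ofReal_mul]
    congr 2
    simp only [NNReal.coe_one, mul_one, sub_zero]
    rw [mul_inv_cancel₀ hpi, one_mul, neg_div]
    rfl
  rw [h1, h]
  push_cast
  congr 2
  ring

lemma timeFT_translate (φ : 𝓢(ℝ, ℝ)) (τ ω : ℝ) :
    timeFT (SchwartzMap.compSubConstCLM ℝ τ φ) ω =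
      Complex.exp (τ * ω * Complex.I) * timeFT φ ω := by
  rw [timeFT, timeFT, ← integral_const_mul,
    ← integral_sub_right_eq_self (fun t : ℝ =>
      Complex.exp (τ * ω * Complex.I) * ((φ t : ℂ) * Complex.exp (ω * t * Complex.I))) τ]
  refine integral_congr_ae (ae_of_all _ fun t => ?_)
  simp only [SchwartzMap.compSubConstCLM_apply]
  have : Complex.exp (ω * t * Complex.I) =
      Complex.exp (τ * ω * Complex.I) * Complex.exp (ω * (t - τ : ℝ) * Complex.I) := by
    rw [← Complex.exp_add]; congr 1; push_cast; ring
  rw [this]; ring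

/-! ### Products of transforms as double time integrals. -/

lemma timeFT_neg (φ : 𝓢(ℝ, ℝ)) (ω : ℝ) : timeFT φ (-ω) = conj (timeFT φ ω) := by
  rw [timeFT, timeFT, ← integral_conj]
  refine integral_congr_ae (ae_of_all _ fun t => ?_)
  simp [← Complex.exp_conj]

lemma continuous_timeFT (φ : 𝓢(ℝ, ℝ)) : Continuous (timeFT φ) := by
  refine continuous_of_dominated (bound := fun t => ‖(φ t : ℂ)‖) ?_ ?_ φ.integrable.ofReal.norm ?_
  · exact fun ω => (integrable_ofReal_mul_exp φ.integrable ω).1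
  · exact fun ω => ae_of_all _ fun t => by rw [norm_mul, norm_exp_mul_I, mul_one]
  · exact ae_of_all _ fun t => by fun_prop

lemma timeFT_mul_conj_eq (φ ψ : 𝓢(ℝ, ℝ)) (ω : ℝ) :
    timeFT φ ω * conj (timeFT ψ ω) =
      ∫ t : ℝ, ∫ t' : ℝ, ((ψ t * φ t' : ℝ) : ℂ) * Complex.exp (-(ω * (t - t')) * Complex.I) := by
  rw [← timeFT_neg, mul_comm]
  simp only [timeFT]
  rw [← integral_mul_const]
  refine integral_congr_ae (ae_of_all _ fun t => ?_)
  simp only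
  rw [← integral_const_mul]
  refine integral_congr_ae (ae_of_all _ fun t' => ?_)
  have : Complex.exp (-(ω * (t - t')) * Complex.I) =
      Complex.exp ((-ω : ℝ) * t * Complex.I) * Complex.exp (ω * t' * Complex.I) := by
    rw [← Complex.exp_add]; congr 1; push_cast; ring
  simp only
  rw [this]; push_cast; ring

lemma integrable_pair (φ ψ : 𝓢(ℝ, ℝ)) (ω : ℝ) :
    Integrable (fun p : ℝ × ℝ =>
      ((ψ p.1 * φ p.2 : ℝ) : ℂ) * Complex.exp (-(ω * (p.1 - p.2)) * Complex.I))
      (volume.prod volume) :=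
  (ψ.integrable.mul_prod φ.integrable).ofReal.mul_bdd (c := 1) (by fun_prop)
    (ae_of_all _ fun p => by simp [Complex.norm_exp])

lemma exp_phase_re (ω t t' : ℝ) :
    (Complex.exp (-(ω * (t - t')) * Complex.I)).re = Real.cos (ω * (t - t')) := by
  have h := Complex.exp_ofReal_mul_I_re (-(ω * (t - t')))
  push_cast at h
  rw [h, Real.cos_neg]

lemma exp_phase_im (ω t t' : ℝ) :
    (Complex.exp (-(ω * (t - t')) * Complex.I)).im = -Real.sin (ω * (t - t')) := by
  have h := Complex.exp_ofReal_mul_I_im (-(ω * (t - t')))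
  push_cast at h
  rw [h, Real.sin_neg]

lemma integral_cos_eq (φ ψ : 𝓢(ℝ, ℝ)) (ω : ℝ) :
    ∫ t : ℝ, ∫ t' : ℝ, ψ t * φ t' * Real.cos (ω * (t - t')) =
      (timeFT φ ω * conj (timeFT ψ ω)).re := by
  have h := integrable_pair φ ψ ω
  rw [timeFT_mul_conj_eq, ← integral_prod (fun p : ℝ × ℝ => ((ψ p.1 * φ p.2 : ℝ) : ℂ) *
    Complex.exp (-(ω * (p.1 - p.2)) * Complex.I)) h, ← RCLike.re_eq_complex_re, ← integral_re h,
    integral_prod _ h.re]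
  refine integral_congr_ae (ae_of_all _ fun t => integral_congr_ae (ae_of_all _ fun t' => ?_))
  simp only [RCLike.re_eq_complex_re, Complex.re_ofReal_mul, exp_phase_re]

lemma integral_sin_eq (φ ψ : 𝓢(ℝ, ℝ)) (ω : ℝ) :
    ∫ t : ℝ, ∫ t' : ℝ, ψ t * φ t' * Real.sin (ω * (t - t')) =
      -(timeFT φ ω * conj (timeFT ψ ω)).im := by
  have h := integrable_pair φ ψ ω
  rw [timeFT_mul_conj_eq, ← integral_prod (fun p : ℝ × ℝ => ((ψ p.1 * φ p.2 : ℝ) : ℂ) *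
    Complex.exp (-(ω * (p.1 - p.2)) * Complex.I)) h, ← RCLike.im_eq_complex_im, ← integral_im h,
    integral_prod _ h.im, ← integral_neg]
  refine integral_congr_ae (ae_of_all _ fun t => ?_)
  simp only [RCLike.im_eq_complex_im, Complex.im_ofReal_mul, exp_phase_im]
  rw [← integral_neg]
  exact integral_congr_ae (ae_of_all _ fun t' => by simp only; ring)

/-! ### The hyperbolic cotangent and the friction kernel -/

lemma coth_neg (x : ℝ) : coth (-x) = -coth x := by
  simp [coth, div_neg]

lemma measurable_coth : Measurable coth :=
  Real.measurable_cosh.div Real.measurable_sinh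

lemma one_le_coth {x : ℝ} (hx : 0 < x) : 1 ≤ coth x := by
  rw [coth, le_div_iff₀ (Real.sinh_pos_iff.2 hx), one_mul]
  exact (Real.sinh_lt_cosh x).le

lemma abs_mul_coth_le (x : ℝ) : |x * coth x| ≤ 1 + |x| := by
  wlog hx : 0 < x generalizing x
  · rcases (not_lt.1 hx).eq_or_lt with rfl | h
    · simp
    · have := this (-x) (by linarith)
      rwa [coth_neg, neg_mul_neg, abs_neg] at this
  have hs : 0 < Real.sinh x := Real.sinh_pos_iff.2 hx
  have h1 := one_le_coth hx
  rw [abs_of_nonneg (by positivity), abs_of_pos hx, coth, mul_div_assoc', div_le_iff₀ hs]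
  have h2 : Real.cosh x - Real.sinh x = Real.exp (-x) := Real.cosh_sub_sinh x
  have h3 : Real.exp (-x) ≤ 1 := Real.exp_le_one_iff.2 (by linarith)
  have h4 : x ≤ Real.sinh x := Real.self_le_sinh_iff.2 hx.le
  nlinarith

namespace System

variable (S : System)

lemma frictionFT_neg (ω : ℝ) : S.frictionFT (-ω) = conj (S.frictionFT ω) := by
  rw [frictionFT, frictionFT, map_add, ← integral_conj, Complex.conj_ofReal]
  congr 1
  refine integral_congr_ae (ae_of_all _ fun t => ?_)
  simp [← Complex.exp_conj]

lemma norm_exp_kernel (ω t : ℝ) : ‖Complex.exp (-(Complex.I * ω * t))‖ = 1 := by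
  simp [Complex.norm_exp]

lemma continuous_frictionFT : Continuous S.frictionFT := by
  refine continuous_const.add (continuous_of_dominated (bound := fun t => ‖(S.k t : ℂ)‖) ?_ ?_
    S.k_integrable_ofReal.norm ?_)
  · exact fun ω => S.k_integrable_ofReal.1.mul (by fun_prop)
  · exact fun ω => ae_of_all _ fun t => by rw [norm_mul, norm_exp_kernel, mul_one]
  · exact ae_of_all _ fun t => by fun_prop

lemma exists_norm_frictionFT_le : ∃ C, ∀ ω, ‖S.frictionFT ω‖ ≤ C := by
  refine ⟨|S.μ₀| + ∫ t in Ioi (0 : ℝ), ‖(S.k t : ℂ)‖, fun ω => ?_⟩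
  refine (norm_add_le _ _).trans (add_le_add (by simp) ?_)
  refine (norm_integral_le_integral_norm _).trans (le_of_eq ?_)
  refine integral_congr_ae (ae_of_all _ fun t => ?_)
  simp only [norm_mul, norm_exp_kernel, mul_one]

/-- `ħω coth(ħω / (2k_BT))`. -/
def thermalEnergy (ω : ℝ) : ℝ := S.ħ * ω * coth (S.ħ * ω / (2 * S.kB * S.T))

lemma thermalEnergy_neg (ω : ℝ) : S.thermalEnergy (-ω) = S.thermalEnergy ω := by
  rw [thermalEnergy, thermalEnergy, mul_neg, neg_div, coth_neg]; ring

lemma measurable_thermalEnergy : Measurable S.thermalEnergy :=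
  (by fun_prop : Measurable fun ω => S.ħ * ω).mul (measurable_coth.comp (by fun_prop))

lemma abs_le_thermalEnergy (ω : ℝ) : |S.ħ * ω| ≤ S.thermalEnergy ω := by
  wlog hω : 0 < ω generalizing ω
  · rcases (not_lt.1 hω).eq_or_lt with rfl | h
    · simp [thermalEnergy]
    · simpa [thermalEnergy_neg] using this (-ω) (by linarith)
  have hħ := S.ħ_pos
  have hk := S.kB_pos
  have hT := S.T_pos
  rw [abs_of_pos (by positivity), thermalEnergy]
  exact le_mul_of_one_le_right (by positivity) (one_le_coth (by positivity))

lemma thermalEnergy_le (ω : ℝ) :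
    S.thermalEnergy ω ≤ (2 * S.kB * S.T + S.ħ) * (1 + |ω|) := by
  have hħ := S.ħ_pos
  have hk := S.kB_pos
  have hT := S.T_pos
  have h := abs_mul_coth_le (S.ħ * ω / (2 * S.kB * S.T))
  have e : S.thermalEnergy ω = 2 * S.kB * S.T *
      (S.ħ * ω / (2 * S.kB * S.T) * coth (S.ħ * ω / (2 * S.kB * S.T))) := by
    rw [thermalEnergy]; field_simp
  rw [e]
  have h' := mul_le_mul_of_nonneg_left ((le_abs_self _).trans h)
    (by positivity : 0 ≤ 2 * S.kB * S.T)
  refine h'.trans ?_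
  rw [mul_add, abs_div, abs_mul, abs_of_pos hħ, abs_of_pos (by positivity : 0 < 2 * S.kB * S.T),
    mul_div_cancel₀ _ (by positivity)]
  nlinarith [abs_nonneg ω, mul_pos hk hT, mul_nonneg (mul_pos hk hT).le (abs_nonneg ω)]

/-- The spectral density `ħω Re μ̃(ω) (coth(ħω / (2k_BT)) + 1)` of the random force. -/
def noise (ω : ℝ) : ℝ := (S.frictionFT ω).re * (S.thermalEnergy ω + S.ħ * ω)

lemma measurable_noise : Measurable S.noise :=
  (Complex.continuous_re.comp S.continuous_frictionFT).measurable.mul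
    (S.measurable_thermalEnergy.add (by fun_prop))

lemma noise_nonneg (hS : S.IsDissipative) (ω : ℝ) : 0 ≤ S.noise ω := by
  -- Dissipation is not assumed at `ω = 0`; there the noise is `0` because `ħω` vanishes, whatever
  -- value `coth` takes.
  rcases eq_or_ne ω 0 with rfl | h
  · simp [noise, thermalEnergy]
  · have h1 := S.abs_le_thermalEnergy ω
    have h2 := neg_abs_le (S.ħ * ω)
    exact mul_nonneg (hS ω h).le (by linarith)

lemma exists_abs_mul_add_le : ∃ C : ℝ, ∀ ω,
    |(S.frictionFT ω).re * S.thermalEnergy ω| ≤ C * (1 + |ω|) ∧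
    |(S.frictionFT ω).re * (S.ħ * ω)| ≤ C * (1 + |ω|) := by
  obtain ⟨C, hC⟩ := S.exists_norm_frictionFT_le
  have hC0 : 0 ≤ C := (norm_nonneg _).trans (hC 0)
  refine ⟨C * (2 * S.kB * S.T + S.ħ), fun ω => ?_⟩
  have h1 := S.abs_le_thermalEnergy ω
  have h2 := S.thermalEnergy_le ω
  have h3 := (Complex.abs_re_le_norm _).trans (hC ω)
  have h4 : |S.thermalEnergy ω| = S.thermalEnergy ω := abs_of_nonneg ((abs_nonneg _).trans h1)
  rw [abs_mul, abs_mul, h4, mul_assoc]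
  exact ⟨mul_le_mul h3 h2 ((abs_nonneg _).trans h1) hC0,
    mul_le_mul h3 (h1.trans h2) (abs_nonneg _) hC0⟩

end System

/-! ### The correlations of the circular force -/

lemma integral_eq_integral_Ioi_add {F : ℝ → ℂ} (hF : Integrable F) :
    ∫ ω, F ω = ∫ ω in Ioi (0 : ℝ), (F ω + F (-ω)) := by
  rw [integral_add hF.integrableOn hF.comp_neg.integrableOn, integral_comp_neg_Ioi, neg_zero,
    add_comm, intervalIntegral.integral_Iic_add_Ioi hF.integrableOn hF.integrableOn]

namespace System

variable (S : System)

lemma integrable_mul_of_weight {h : ℝ → ℝ} (hm : Measurable h) {C : ℝ}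
    (hC : ∀ ω, |h ω| ≤ C * (1 + |ω|)) {P : ℝ → ℂ} (hP : Continuous P)
    (hd : Integrable fun ω => (1 + |ω|) * ‖P ω‖) : Integrable fun ω => (h ω : ℂ) * P ω := by
  refine (hd.const_mul C).mono' ?_ (ae_of_all _ fun ω => ?_)
  · exact ((Complex.measurable_ofReal.comp hm).mul hP.measurable).aestronglyMeasurable
  · rw [norm_mul, Complex.norm_real, Real.norm_eq_abs, ← mul_assoc]
    exact mul_le_mul_of_nonneg_right (hC ω) (norm_nonneg _)

end System

/-- A product is half the sum of anticommutator and commutator, whence `coth + 1`. The thermal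
weight is even and pairs with the even `Re P`, the weight `ħω Re μ̃` is odd and pairs with the odd
`Im P`, so the two half-line integrals unfold to one over the whole line. -/
lemma IsBathForce.circular_correlation {A : Type*} [Ring A] [StarRing A] [Algebra ℂ A]
    [StarModule ℂ A] {S : System} {ρ : A →ₗ[ℂ] ℂ} {f : Fin 2 → 𝓢(ℝ, ℝ) →ₗ[ℝ] A}
    (hf : IsBathForce S ρ f) {σ : ℝ} (hσ : σ ^ 2 = 1) (φ ψ : 𝓢(ℝ, ℝ))
    (hd : Integrable fun ω => (1 + |ω|) * ‖timeFT φ ω * conj (timeFT ψ ω)‖) :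
    ρ (star (circular σ (fun α => f α) ψ) * circular σ (fun α => f α) φ) =
      (Real.pi : ℂ)⁻¹ * ∫ ω, (S.noise ω : ℂ) * (timeFT φ ω * conj (timeFT ψ ω)) := by
  set P : ℝ → ℂ := fun ω => timeFT φ ω * conj (timeFT ψ ω) with hPdef
  have hPc : Continuous P := (continuous_timeFT φ).mul
    (Complex.continuous_conj.comp (continuous_timeFT ψ))
  have hPneg (ω : ℝ) : P (-ω) = conj (P ω) := by simp [hPdef, timeFT_neg]
  obtain ⟨C, hC⟩ := S.exists_abs_mul_add_le
  have hre : Measurable fun ω => (S.frictionFT ω).re :=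
    (Complex.continuous_re.comp S.continuous_frictionFT).measurable
  have ia := System.integrable_mul_of_weight
    (h := fun ω => (S.frictionFT ω).re * S.thermalEnergy ω) (hre.mul S.measurable_thermalEnergy)
    (fun ω => (hC ω).1) hPc hd
  have ib := System.integrable_mul_of_weight (h := fun ω => (S.frictionFT ω).re * (S.ħ * ω))
    (hre.mul (by fun_prop)) (fun ω => (hC ω).2) hPc hd
  have hanti (α : Fin 2) : ρ (f α ψ * f α φ + f α φ * f α ψ) =
      (2 / Real.pi) * ∫ ω in Ioi (0 : ℝ),
        ((S.frictionFT ω).re * S.thermalEnergy ω : ℂ) * (P ω).re := by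
    rw [hf.anticommutator, if_pos rfl]
    push_cast
    rw [← integral_complex_ofReal]
    congr 1
    refine integral_congr_ae (ae_of_all _ fun ω => ?_)
    simp only
    rw [integral_cos_eq]
    simp only [System.thermalEnergy]
    push_cast
    ring
  have hcomm (α : Fin 2) : ρ (f α ψ * f α φ - f α φ * f α ψ) =
      (2 * Complex.I / Real.pi) * ∫ ω in Ioi (0 : ℝ),
        ((S.frictionFT ω).re * (S.ħ * ω) : ℂ) * (P ω).im := by
    rw [hf.commutator, if_pos rfl, ← integral_complex_ofReal]
    have : (2 / (Complex.I * Real.pi) : ℂ) = (2 * Complex.I / Real.pi) * (-1) := by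
      have := Complex.I_ne_zero
      have hpi : (Real.pi : ℂ) ≠ 0 := by exact_mod_cast Real.pi_ne_zero
      field_simp
      simp
    rw [this, mul_assoc, ← integral_const_mul]
    congr 1
    refine integral_congr_ae (ae_of_all _ fun ω => ?_)
    simp only
    rw [integral_sin_eq]
    push_cast
    ring
  have hoff (α β : Fin 2) (h : α ≠ β) : ρ (f α ψ * f β φ) = 0 := by
    have h1 := hf.anticommutator α β ψ φ
    have h2 := hf.commutator α β ψ φ
    rw [if_neg h, map_add] at h1
    rw [if_neg h, map_sub] at h2
    linear_combination (h1 + h2) / 2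
  have hdiag : ρ (f 0 ψ * f 0 φ) + ρ (f 1 ψ * f 1 φ) =
      (2 / Real.pi) * (∫ ω in Ioi (0 : ℝ),
        ((S.frictionFT ω).re * S.thermalEnergy ω : ℂ) * (P ω).re) +
      (2 * Complex.I / Real.pi) * ∫ ω in Ioi (0 : ℝ),
        ((S.frictionFT ω).re * (S.ħ * ω) : ℂ) * (P ω).im := by
    have a0 := hanti 0
    have a1 := hanti 1
    have c0 := hcomm 0
    have c1 := hcomm 1
    rw [map_add] at a0 a1
    rw [map_sub] at c0 c1
    linear_combination (a0 + a1 + c0 + c1) / 2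
  have hσ' : (σ : ℂ) ^ 2 = 1 := by exact_mod_cast hσ
  rw [star_circular_mul (F := fun α => f α) (fun α φ => hf.selfAdjoint α φ), hσ', one_mul,
    hoff 0 1 (by decide), hoff 1 0 (by decide), sub_zero, mul_zero, add_zero, hdiag]
  have hint : Integrable fun ω => (S.noise ω : ℂ) * P ω := by
    refine (ia.add ib).congr (ae_of_all _ fun ω => ?_)
    simp only [Pi.add_apply, System.noise]
    push_cast; ring
  have iar : Integrable fun ω =>
      ((S.frictionFT ω).re * S.thermalEnergy ω : ℂ) * (P ω).re := by
    refine ia.re.ofReal.congr (ae_of_all _ fun ω => ?_)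
    simp only [RCLike.re_eq_complex_re, Complex.re_ofReal_mul]
    simp
  have ibi : Integrable fun ω => ((S.frictionFT ω).re * (S.ħ * ω) : ℂ) * (P ω).im := by
    refine ib.im.ofReal.congr (ae_of_all _ fun ω => ?_)
    simp only [RCLike.im_eq_complex_im, Complex.im_ofReal_mul]
    simp
  rw [integral_eq_integral_Ioi_add hint]
  have e (ω : ℝ) : (S.noise ω : ℂ) * P ω + (S.noise (-ω) : ℂ) * P (-ω) =
      2 * (((S.frictionFT ω).re * S.thermalEnergy ω : ℂ) * (P ω).re) +
      2 * Complex.I * (((S.frictionFT ω).re * (S.ħ * ω) : ℂ) * (P ω).im) := by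
    rw [hPneg]
    simp only [System.noise, S.thermalEnergy_neg, S.frictionFT_neg, Complex.conj_re]
    conv_lhs => rw [← Complex.re_add_im (P ω)]
    simp only [map_add, map_mul, Complex.conj_ofReal, Complex.conj_I]
    push_cast
    ring
  simp_rw [e]
  rw [integral_add (iar.integrableOn.const_mul _) (ibi.integrableOn.const_mul _),
    integral_const_mul, integral_const_mul]
  ring

/-! ### The spectral density of the circular components -/

namespace System

variable (S : System)

lemma continuous_symbol (σ : ℝ) : Continuous (S.symbol σ) := by
  have := S.continuous_frictionFT
  unfold symbol
  fun_prop

lemma symbol_re (σ ω : ℝ) : (S.symbol σ ω).re =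
    S.m * (S.ω₀ ^ 2 - ω ^ 2) - ω * (S.frictionFT ω).im - σ * (S.e * S.B / S.c) * ω := by
  simp [symbol, ← Complex.ofReal_pow]
  ring

lemma symbol_im (σ ω : ℝ) : (S.symbol σ ω).im = ω * (S.frictionFT ω).re := by
  simp [symbol, ← Complex.ofReal_pow]

lemma symbol_ne_zero (hS : S.IsDissipative) (σ ω : ℝ) : S.symbol σ ω ≠ 0 := by
  intro h
  rcases eq_or_ne ω 0 with rfl | hω
  · simp [symbol, S.m_pos.ne', S.ω₀_pos.ne'] at h
  · have him := S.symbol_im σ ω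
    rw [h, Complex.zero_im, eq_comm, mul_eq_zero] at him
    rcases him with h1 | h1
    · exact hω h1
    · exact (hS ω hω).ne' h1

/-- The spectral density of the circular component `x + iσy`, `σ = ±1`. -/
def spectralDensity (σ ω : ℝ) : ℝ := S.noise ω / (Real.pi * ‖S.symbol σ ω‖ ^ 2)

lemma measurable_spectralDensity (σ : ℝ) : Measurable (S.spectralDensity σ) :=
  S.measurable_noise.div ((S.continuous_symbol σ).norm.measurable.pow_const 2 |>.const_mul _)

lemma spectralDensity_nonneg (hS : S.IsDissipative) (σ ω : ℝ) : 0 ≤ S.spectralDensity σ ω :=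
  div_nonneg (S.noise_nonneg hS ω) (by positivity)

end System

/-! ### Identification of the spectral measure. -/

lemma integrable_weight_mul_gaussian :
    Integrable fun ω : ℝ => (1 + |ω|) * ‖timeFT gaussianTest ω‖ ^ 2 := by
  have h1 := integrable_exp_neg_mul_sq (b := 1) one_pos
  have h2 := (integrable_mul_exp_neg_mul_sq (b := 1) one_pos).norm
  refine ((h1.add h2).const_mul (2 * Real.pi)).congr (ae_of_all _ fun ω => ?_)
  simp only [Pi.add_apply]
  rw [timeFT_gaussianTest, Complex.norm_real, Real.norm_eq_abs (_ * Real.exp (-(ω ^ 2 / 2))),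
    sq_abs, mul_pow, Real.sq_sqrt (by positivity), norm_mul, Real.norm_eq_abs, Real.norm_eq_abs,
    Real.abs_exp, ← Real.exp_nat_mul]
  push_cast
  rw [show (2 : ℝ) * -(ω ^ 2 / 2) = -1 * ω ^ 2 by ring]
  ring

/-- The two-time correlations of a circular component in the steady state. -/
theorem IsSteadyState.circular_correlation {A : Type*} [Ring A] [StarRing A] [Algebra ℂ A]
    [StarModule ℂ A] {S : System} {ρ : A →ₗ[ℂ] ℂ} {f : Fin 2 → 𝓢(ℝ, ℝ) →ₗ[ℝ] A}
    {r : Fin 2 → ℝ → A} (hS : S.IsDissipative) (hρ : IsState ρ) (hf : IsBathForce S ρ f)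
    (hr : IsSteadyState S ρ f r) {σ : ℝ} (hσ : σ ^ 2 = 1) (u : ℝ) :
    ρ (star (circular σ r 0) * circular σ r u) =
      ∫ ω, (S.spectralDensity σ ω : ℂ) * Complex.exp (u * ω * Complex.I) := by
  obtain ⟨ν, hν, hchar, hcorr⟩ := hr.exists_spectralMeasure hρ hσ
  set G : ℝ → ℝ := fun ω => ‖timeFT gaussianTest ω‖ ^ 2 with hG
  have hGc : Continuous G := (continuous_timeFT _).norm.pow 2
  have hGpos (ω : ℝ) : 0 < G ω := by
    refine pow_pos (norm_pos_iff.2 ?_) 2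
    rw [timeFT_gaussianTest, Complex.ofReal_ne_zero]
    positivity
  have hsymb (ω : ℝ) : 0 < ‖S.symbol σ ω‖ := norm_pos_iff.2 (S.symbol_ne_zero hS σ ω)
  set H : ℝ → ℝ := fun ω => ‖S.symbol σ ω‖ ^ 2 * G ω with hH
  have hHc : Continuous H := ((S.continuous_symbol σ).norm.pow 2).mul hGc
  have hHpos (ω : ℝ) : 0 < H ω := mul_pos (pow_pos (hsymb ω) 2) (hGpos ω)
  set N : ℝ → ℝ := fun ω => S.noise ω * G ω / Real.pi with hN
  have hNm : Measurable N := (S.measurable_noise.mul hGc.measurable).div_const _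
  have hN0 (ω : ℝ) : 0 ≤ N ω :=
    div_nonneg (mul_nonneg (S.noise_nonneg hS ω) (hGpos ω).le) Real.pi_pos.le
  have hpair (τ ω : ℝ) : timeFT (SchwartzMap.compSubConstCLM ℝ τ gaussianTest) ω *
      conj (timeFT gaussianTest ω) = G ω * Complex.exp (τ * ω * Complex.I) := by
    rw [timeFT_translate, mul_assoc, Complex.mul_conj, Complex.normSq_eq_norm_sq]
    ring
  -- Translating one Gaussian by `τ` inserts the character `e^{iτω}`, so the two force correlations
  -- become characteristic functions of `H ν` and `N dω`.
  have hkey (τ : ℝ) : ∫ ω, (H ω : ℂ) * Complex.exp (τ * ω * Complex.I) ∂ν =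
      ∫ ω, (N ω : ℂ) * Complex.exp (τ * ω * Complex.I) := by
    have h1 := hcorr (SchwartzMap.compSubConstCLM ℝ τ gaussianTest) gaussianTest
    have h2 := hf.circular_correlation hσ (SchwartzMap.compSubConstCLM ℝ τ gaussianTest)
      gaussianTest (by
        refine integrable_weight_mul_gaussian.congr (ae_of_all _ fun ω => ?_)
        simp only [hpair, norm_mul, norm_exp_mul_I, mul_one, Complex.norm_real, Real.norm_eq_abs,
          hG, abs_pow, abs_norm])
    rw [h1] at h2
    simp_rw [hpair] at h2
    rw [← integral_const_mul] at h2
    refine Eq.trans ?_ (h2.trans ?_)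
    · refine integral_congr_ae (ae_of_all _ fun ω => ?_)
      simp only [map_mul]
      rw [mul_mul_mul_comm, hpair, Complex.mul_conj, Complex.normSq_eq_norm_sq]
      simp only [hH]
      push_cast; ring
    · refine integral_congr_ae (ae_of_all _ fun ω => ?_)
      simp only [hN]
      push_cast; ring
  have hHint : Integrable H ν := by
    refine Integrable.of_bound hHc.aestronglyMeasurable
      ((∫ t, ‖S.circularAdjoint σ gaussianTest t‖) ^ 2) (ae_of_all _ fun ω => ?_)
    rw [Real.norm_eq_abs, abs_of_pos (hHpos ω)]
    simp only [hH, hG]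
    rw [← mul_pow, ← norm_mul]
    exact pow_le_pow_left₀ (norm_nonneg _) (S.norm_symbol_mul_timeFT_le σ _ ω) 2
  have hNint : Integrable N := by
    obtain ⟨C, hC⟩ := S.exists_abs_mul_add_le
    refine (integrable_weight_mul_gaussian.const_mul (2 * C / Real.pi)).mono'
      hNm.aestronglyMeasurable (ae_of_all _ fun ω => ?_)
    rw [Real.norm_eq_abs, abs_of_nonneg (hN0 ω)]
    have h1 : S.noise ω ≤ 2 * C * (1 + |ω|) := by
      rw [System.noise, mul_add]
      linarith [(le_abs_self _).trans (hC ω).1, (le_abs_self _).trans (hC ω).2]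
    have h2 := mul_le_mul_of_nonneg_right h1 (hGpos ω).le
    simp only [hN]
    rw [div_mul_eq_mul_div, div_le_div_iff_of_pos_right Real.pi_pos, ← mul_assoc]
    exact h2
  have hmeas : ν.withDensity (fun ω => ENNReal.ofReal (H ω)) =
      volume.withDensity (fun ω => ENNReal.ofReal (N ω)) := by
    have := isFiniteMeasure_withDensity_ofReal hHint.2
    have := isFiniteMeasure_withDensity_ofReal hNint.2
    refine Measure.ext_of_charFun (funext fun τ => ?_)
    rw [charFun_apply_real, charFun_apply_real,
      integral_withDensity_eq_integral_toReal_smul hHc.measurable.ennreal_ofReal (by simp),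
      integral_withDensity_eq_integral_toReal_smul hNm.ennreal_ofReal (by simp)]
    simp only [ENNReal.toReal_ofReal (hHpos _).le, ENNReal.toReal_ofReal (hN0 _),
      Complex.real_smul]
    exact hkey τ
  have hν' : ν = volume.withDensity (fun ω => ENNReal.ofReal (S.spectralDensity σ ω)) := by
    have h1 := withDensity_inv_same (μ := ν) hHc.measurable.ennreal_ofReal
      (ae_of_all _ fun ω => by simpa using hHpos ω) (by simp)
    rw [hmeas] at h1
    refine h1.symm.trans ((withDensity_mul volume hNm.ennreal_ofReal
      hHc.measurable.ennreal_ofReal.inv).symm.trans ?_)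
    congr 1
    ext1 ω
    simp only [Pi.mul_apply, Pi.inv_apply]
    rw [← ENNReal.ofReal_inv_of_pos (hHpos ω), ← ENNReal.ofReal_mul (hN0 ω)]
    congr 1
    simp only [hN, hH, System.spectralDensity]
    have := (hGpos ω).ne'
    have := (hsymb ω).ne'
    field_simp
  rw [hchar, charFun_apply_real, hν', integral_withDensity_eq_integral_toReal_smul
    (S.measurable_spectralDensity σ).ennreal_ofReal (by simp)]
  simp only [ENNReal.toReal_ofReal (S.spectralDensity_nonneg hS σ _), Complex.real_smul]

/-! ### The relaxation function -/

namespace System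

variable (S : System)

lemma symbol_neg (σ ω : ℝ) : S.symbol σ (-ω) = conj (S.symbol (-σ) ω) := by
  apply Complex.ext
  · rw [Complex.conj_re, symbol_re, symbol_re, frictionFT_neg, Complex.conj_im]; ring
  · rw [Complex.conj_im, symbol_im, symbol_im, frictionFT_neg, Complex.conj_re]; ring

/-- With this sign of `ω_c`, `Φ(ω)` belongs to `σ = -1`; the component `σ = 1` sees `Φ(-ω)` through
`symbol_neg`. -/
lemma relaxation_eq (ω : ℝ) :
    S.relaxation ω = S.m * (S.frictionFT ω).re / ‖S.symbol (-1) ω‖ ^ 2 := by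
  have hm := S.m_pos.ne'
  have hc := S.c_pos.ne'
  have hre : (S.gammaFT ω).re = (S.frictionFT ω).re / S.m := by
    rw [gammaFT, Complex.div_ofReal_re]
  have him : (S.gammaFT ω).im = (S.frictionFT ω).im / S.m := by
    rw [gammaFT, Complex.div_ofReal_im]
  have hden : ‖S.symbol (-1) ω‖ ^ 2 = S.m ^ 2 *
      ((ω ^ 2 - S.ω₀ ^ 2 - ω * S.cyclotron + ω * (S.gammaFT ω).im) ^ 2
      + (ω * (S.gammaFT ω).re) ^ 2) := by
    rw [← Complex.normSq_eq_norm_sq, Complex.normSq_apply, symbol_re, symbol_im, hre, him,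
      cyclotron]
    field_simp
    ring
  rw [relaxation, hden, hre, show S.m * (S.frictionFT ω).re =
    S.m ^ 2 * ((S.frictionFT ω).re / S.m) by field_simp,
    mul_div_mul_left _ _ (pow_ne_zero 2 hm)]

lemma spectralDensity_neg_one (ω : ℝ) : S.spectralDensity (-1) ω =
    (Real.pi * S.m)⁻¹ * ((S.thermalEnergy ω + S.ħ * ω) * S.relaxation ω) := by
  have hm := S.m_pos.ne'
  rw [spectralDensity, relaxation_eq, noise, ← div_div]
  field_simp

lemma spectralDensity_one (ω : ℝ) : S.spectralDensity 1 ω =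
    (Real.pi * S.m)⁻¹ * ((S.thermalEnergy ω + S.ħ * ω) * S.relaxation (-ω)) := by
  have hm := S.m_pos.ne'
  rw [spectralDensity, relaxation_eq, symbol_neg, frictionFT_neg, noise, ← div_div, neg_neg,
    Complex.norm_conj, Complex.conj_re]
  field_simp

/-- At high frequency `m ω²` dominates, friction being bounded; on a compact interval the symbol is
continuous without zeros. -/
lemma exists_le_norm_symbol (hS : S.IsDissipative) (σ : ℝ) :
    ∃ C : ℝ, 0 < C ∧ ∀ ω, 1 + ω ^ 2 ≤ C * ‖S.symbol σ ω‖ := by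
  have hm := S.m_pos
  obtain ⟨K, hK⟩ := S.exists_norm_frictionFT_le
  have hK0 : 0 ≤ K := (norm_nonneg _).trans (hK 0)
  set L := K + |σ * (S.e * S.B / S.c)| with hL
  have hL0 : 0 ≤ L := by positivity
  set D := S.m * S.ω₀ ^ 2 + L + S.m / 2 with hD
  -- For `|ω| > R` one has `|ω| ≥ 1` and `D |ω| ≤ (m/2) ω²`, so the lower-order terms, with `m/2` to
  -- spare, cost at most half of `m ω²`.
  set R := 1 + 2 / S.m * D with hR
  have hcont : Continuous fun ω => (1 + ω ^ 2) / ‖S.symbol σ ω‖ :=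
    (by fun_prop : Continuous fun ω : ℝ => 1 + ω ^ 2).div (S.continuous_symbol σ).norm
      fun ω => (norm_pos_iff.2 (S.symbol_ne_zero hS σ ω)).ne'
  obtain ⟨C, hC⟩ := (isCompact_Icc (a := -R) (b := R)).exists_bound_of_continuousOn
    hcont.continuousOn
  refine ⟨max C (2 / S.m), lt_max_of_lt_right (by positivity), fun ω => ?_⟩
  have hpos := norm_pos_iff.2 (S.symbol_ne_zero hS σ ω)
  rcases le_or_gt |ω| R with h | h
  · have h1 := (le_abs_self _).trans (hC ω (abs_le.1 h))
    rw [div_le_iff₀ hpos] at h1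
    exact h1.trans (mul_le_mul_of_nonneg_right (le_max_left _ _) hpos.le)
  · have h1 : S.m / 2 * (1 + ω ^ 2) ≤ ‖S.symbol σ ω‖ := by
      have hre := S.symbol_re σ ω
      have h2 : |ω * (S.frictionFT ω).im + σ * (S.e * S.B / S.c) * ω| ≤ L * |ω| := by
        refine (abs_add_le _ _).trans ?_
        rw [abs_mul, abs_mul _ ω]
        have := (Complex.abs_im_le_norm _).trans (hK ω)
        nlinarith [abs_nonneg ω]
      have h3 := neg_le_abs (S.symbol σ ω).re
      have h4 := Complex.abs_re_le_norm (S.symbol σ ω)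
      have h5 : D * |ω| ≤ S.m / 2 * ω ^ 2 := by
        have h6 : D ≤ S.m / 2 * |ω| := by
          have : 2 / S.m * D ≤ |ω| := by linarith
          rw [div_mul_eq_mul_div, div_le_iff₀ hm] at this
          linarith
        rw [← sq_abs]
        nlinarith [abs_nonneg ω]
      have hR1 : 1 ≤ |ω| := by
        have : 0 ≤ 2 / S.m * D := by positivity
        linarith
      have h7 := (abs_le.1 h2).1
      have h8 : S.m * S.ω₀ ^ 2 + L * |ω| + S.m / 2 ≤ D * |ω| := by
        rw [hD]
        nlinarith [mul_nonneg (by positivity : 0 ≤ S.m * S.ω₀ ^ 2 + S.m / 2)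
          (sub_nonneg.2 hR1)]
      nlinarith
    have h9 : 2 / S.m * ‖S.symbol σ ω‖ ≤ max C (2 / S.m) * ‖S.symbol σ ω‖ :=
      mul_le_mul_of_nonneg_right (le_max_right _ _) hpos.le
    refine le_trans ?_ h9
    rw [div_mul_eq_mul_div, le_div_iff₀ hm]
    linarith

lemma exists_relaxation_le (hS : S.IsDissipative) :
    ∃ C : ℝ, ∀ ω, |S.relaxation ω| * (1 + ω ^ 2) ^ 2 ≤ C := by
  obtain ⟨K, hK⟩ := S.exists_norm_frictionFT_le
  obtain ⟨C, hC0, hC⟩ := S.exists_le_norm_symbol hS (-1)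
  have hm := S.m_pos
  refine ⟨S.m * K * C ^ 2, fun ω => ?_⟩
  have hpos := norm_pos_iff.2 (S.symbol_ne_zero hS (-1) ω)
  have hre := (Complex.abs_re_le_norm _).trans (hK ω)
  rw [relaxation_eq, abs_div, abs_mul, abs_of_pos hm, abs_of_pos (pow_pos hpos 2),
    div_mul_eq_mul_div, div_le_iff₀ (pow_pos hpos 2), mul_assoc, mul_assoc, mul_assoc, ← mul_pow]
  refine mul_le_mul_of_nonneg_left ?_ hm.le
  exact mul_le_mul hre (pow_le_pow_left₀ (by positivity) (hC ω) 2) (by positivity)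
    ((abs_nonneg _).trans hre)

lemma measurable_relaxation : Measurable S.relaxation := by
  have h : S.relaxation = fun ω => S.m * (S.frictionFT ω).re / ‖S.symbol (-1) ω‖ ^ 2 :=
    funext S.relaxation_eq
  rw [h]
  exact ((Complex.continuous_re.comp S.continuous_frictionFT).measurable.const_mul _).div
    ((S.continuous_symbol (-1)).norm.measurable.pow_const 2)

lemma integrable_mul_relaxation (hS : S.IsDissipative) {h : ℝ → ℝ} (hm : Measurable h) {D : ℝ}
    (hD : ∀ ω, |h ω| ≤ D * (1 + ω ^ 2)) : Integrable fun ω => h ω * S.relaxation ω := by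
  obtain ⟨C, hC⟩ := S.exists_relaxation_le hS
  have hD0 : 0 ≤ D := by simpa using (abs_nonneg _).trans (hD 0)
  refine (integrable_inv_one_add_sq.const_mul (D * C)).mono'
    (hm.mul S.measurable_relaxation).aestronglyMeasurable (ae_of_all _ fun ω => ?_)
  have hpos : 0 < 1 + ω ^ 2 := by positivity
  rw [norm_mul, Real.norm_eq_abs, Real.norm_eq_abs, ← div_eq_mul_inv, le_div_iff₀ hpos]
  calc |h ω| * |S.relaxation ω| * (1 + ω ^ 2)
      ≤ D * (1 + ω ^ 2) * |S.relaxation ω| * (1 + ω ^ 2) := by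
        gcongr; exact hD ω
    _ = D * (|S.relaxation ω| * (1 + ω ^ 2) ^ 2) := by ring
    _ ≤ D * C := mul_le_mul_of_nonneg_left (hC ω) hD0

lemma exists_abs_thermal_le : ∃ D : ℝ, ∀ ω,
    |S.thermalEnergy ω| ≤ D * (1 + ω ^ 2) ∧ |S.ħ * ω| ≤ D * (1 + ω ^ 2) ∧
    |ω * S.thermalEnergy ω| ≤ D * (1 + ω ^ 2) ∧ |ω * (S.ħ * ω)| ≤ D * (1 + ω ^ 2) := by
  set E := 2 * S.kB * S.T + S.ħ with hE
  have hE0 : 0 ≤ E := by have := S.kB_pos; have := S.T_pos; have := S.ħ_pos; positivity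
  refine ⟨2 * E, fun ω => ?_⟩
  have h1 := S.abs_le_thermalEnergy ω
  have h2 := S.thermalEnergy_le ω
  have h0 : 0 ≤ S.thermalEnergy ω := (abs_nonneg _).trans h1
  have h3 : E * (1 + |ω|) ≤ 2 * E * (1 + ω ^ 2) := by
    nlinarith [mul_nonneg hE0 (sq_nonneg (|ω| - 1)), sq_abs ω, mul_nonneg hE0 (sq_nonneg ω)]
  have h4 : |ω| * (E * (1 + |ω|)) ≤ 2 * E * (1 + ω ^ 2) := by
    nlinarith [mul_nonneg hE0 (sq_nonneg (|ω| - 1)), sq_abs ω, mul_nonneg hE0 (sq_nonneg ω)]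
  have h5 := (mul_le_mul_of_nonneg_left h2 (abs_nonneg ω)).trans h4
  refine ⟨?_, (h1.trans h2).trans h3, ?_, ?_⟩
  · rw [abs_of_nonneg h0]; exact h2.trans h3
  · rw [abs_mul, abs_of_nonneg h0]; exact h5
  · rw [abs_mul]
    exact (mul_le_mul_of_nonneg_left h1 (abs_nonneg ω)).trans h5

lemma integrable_thermal (hS : S.IsDissipative) :
    Integrable (fun ω => S.thermalEnergy ω * S.relaxation ω) ∧
    Integrable (fun ω => S.ħ * ω * S.relaxation ω) ∧
    Integrable (fun ω => ω * S.thermalEnergy ω * S.relaxation ω) ∧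
    Integrable (fun ω => ω * (S.ħ * ω) * S.relaxation ω) := by
  obtain ⟨D, hD⟩ := S.exists_abs_thermal_le
  have hE := S.measurable_thermalEnergy
  exact ⟨S.integrable_mul_relaxation hS hE fun ω => (hD ω).1,
    S.integrable_mul_relaxation hS (by fun_prop) fun ω => (hD ω).2.1,
    S.integrable_mul_relaxation hS (measurable_id.mul hE) fun ω => (hD ω).2.2.1,
    S.integrable_mul_relaxation hS (by fun_prop) fun ω => (hD ω).2.2.2⟩

lemma integrable_spectralDensity (hS : S.IsDissipative) :
    Integrable (S.spectralDensity 1) ∧ Integrable (S.spectralDensity (-1)) := by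
  obtain ⟨h1, h2, -, -⟩ := S.integrable_thermal hS
  refine ⟨(((h1.comp_neg.sub h2.comp_neg).const_mul (Real.pi * S.m)⁻¹)).congr
    (ae_of_all _ fun ω => ?_), ((h1.add h2).const_mul (Real.pi * S.m)⁻¹).congr
    (ae_of_all _ fun ω => ?_)⟩
  · simp only [Pi.sub_apply, spectralDensity_one, thermalEnergy_neg]; ring
  · simp only [Pi.add_apply, spectralDensity_neg_one]; ring

lemma mul_spectralDensity_one (ω : ℝ) : ω * S.spectralDensity 1 ω = (Real.pi * S.m)⁻¹ *
    (-ω * (S.ħ * -ω) * S.relaxation (-ω) - -ω * S.thermalEnergy (-ω) * S.relaxation (-ω)) := by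
  rw [spectralDensity_one, thermalEnergy_neg]; ring

lemma mul_spectralDensity_neg_one (ω : ℝ) : ω * S.spectralDensity (-1) ω = (Real.pi * S.m)⁻¹ *
    (ω * (S.ħ * ω) * S.relaxation ω + ω * S.thermalEnergy ω * S.relaxation ω) := by
  rw [spectralDensity_neg_one]; ring

lemma integrable_mul_spectralDensity (hS : S.IsDissipative) :
    Integrable (fun ω => ω * S.spectralDensity 1 ω) ∧
      Integrable (fun ω => ω * S.spectralDensity (-1) ω) := by
  obtain ⟨-, -, h3, h4⟩ := S.integrable_thermal hS
  simp_rw [mul_spectralDensity_one, mul_spectralDensity_neg_one]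
  exact ⟨(h4.comp_neg.sub h3.comp_neg).const_mul _, (h4.add h3).const_mul _⟩

/-- After `ω ↦ -ω` in the first integral, the `ħω` terms agree and cancel, while the thermal terms
have opposite signs and add. -/
lemma integral_mul_spectralDensity_sub (hS : S.IsDissipative) :
    (∫ ω, ω * S.spectralDensity 1 ω) - ∫ ω, ω * S.spectralDensity (-1) ω =
      -(2 * (Real.pi * S.m)⁻¹ * ∫ ω, ω * S.thermalEnergy ω * S.relaxation ω) := by
  obtain ⟨-, -, h3, h4⟩ := S.integrable_thermal hS
  simp_rw [mul_spectralDensity_one, mul_spectralDensity_neg_one]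
  rw [integral_const_mul, integral_const_mul, integral_sub h4.comp_neg h3.comp_neg,
    integral_add h4 h3, integral_neg_eq_self (fun ω => ω * (S.ħ * ω) * S.relaxation ω),
    integral_neg_eq_self (fun ω => ω * S.thermalEnergy ω * S.relaxation ω)]
  ring

lemma thermalBohrMagneton_mul_sq (ω : ℝ) : S.thermalBohrMagneton ω * ω ^ 2 =
    -(|S.e| / (2 * S.m * S.c)) * (ω * S.thermalEnergy ω) := by
  rw [thermalBohrMagneton, bohrMagneton, thermalEnergy]
  ring

lemma thermalBohrMagneton_mul_momentDensity (ω : ℝ) :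
    S.thermalBohrMagneton ω * S.momentDensity ω =
      -(|S.e| / (2 * S.m * S.c)) * Real.pi⁻¹ * (ω * S.thermalEnergy ω * S.relaxation ω) := by
  have h := S.thermalBohrMagneton_mul_sq ω
  rw [momentDensity]
  linear_combination Real.pi⁻¹ * S.relaxation ω * h

lemma thermalBohrMagneton_mul_sub (ω : ℝ) :
    S.thermalBohrMagneton ω * ω ^ 2 * (S.relaxation ω - S.relaxation (-ω)) =
      -(|S.e| / (2 * S.m * S.c)) * (ω * S.thermalEnergy ω * S.relaxation ω +
        -ω * S.thermalEnergy (-ω) * S.relaxation (-ω)) := by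
  rw [thermalBohrMagneton_mul_sq, thermalEnergy_neg]; ring

end System

/-! ### The derivative at coinciding times and the magnetic moment. -/

lemma hasDerivAt_integral_mul_exp {w : ℝ → ℝ} (h0 : Integrable w)
    (h1 : Integrable fun ω => ω * w ω) :
    HasDerivAt (fun u : ℝ => ∫ ω, (w ω : ℂ) * Complex.exp (u * ω * Complex.I))
      (Complex.I * (∫ ω, ω * w ω : ℝ)) 0 := by
  have h := (hasDerivAt_integral_of_dominated_loc_of_deriv_le (μ := volume) (𝕜 := ℝ)
    (F := fun (u ω : ℝ) => (w ω : ℂ) * Complex.exp (u * ω * Complex.I))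
    (F' := fun (u ω : ℝ) => (w ω : ℂ) * (Complex.exp (u * ω * Complex.I) * (ω * Complex.I)))
    (x₀ := 0) (s := univ) (bound := fun ω => ‖ω * w ω‖) univ_mem
    (.of_forall fun u => h0.ofReal.1.mul (by fun_prop))
    ((h0.ofReal (𝕜 := ℂ)).congr (ae_of_all _ fun ω => by simp))
    (h0.ofReal.1.mul (by fun_prop))
    (ae_of_all _ fun ω u _ => by
      rw [norm_mul, norm_mul, norm_exp_mul_I]
      simp [mul_comm]) h1.norm
    (ae_of_all _ fun ω u _ => by
      have h2 : HasDerivAt (fun u : ℝ => (u * ω * Complex.I : ℂ)) (ω * Complex.I) u := by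
        simpa using ((Complex.ofRealCLM.hasDerivAt (x := u)).mul_const (ω : ℂ)).mul_const Complex.I
      exact h2.cexp.const_mul _)).2
  refine h.congr_deriv ?_
  rw [← integral_complex_ofReal, ← integral_const_mul]
  refine integral_congr_ae (ae_of_all _ fun ω => ?_)
  simp
  ring

theorem IsSteadyState.isMagneticMoment {A : Type*} [Ring A] [StarRing A] [Algebra ℂ A]
    [StarModule ℂ A] {S : System} {ρ : A →ₗ[ℂ] ℂ} {f : Fin 2 → 𝓢(ℝ, ℝ) →ₗ[ℝ] A}
    {r : Fin 2 → ℝ → A} (hS : S.IsDissipative) (hρ : IsState ρ) (hf : IsBathForce S ρ f)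
    (hr : IsSteadyState S ρ f r) :
    IsMagneticMoment S ρ r (-(|S.e| / (2 * S.m * S.c)) * Real.pi⁻¹ *
      ∫ ω, ω * S.thermalEnergy ω * S.relaxation ω) := by
  intro t
  have hp := hasDerivAt_integral_mul_exp (S.integrable_spectralDensity hS).1
    (S.integrable_mul_spectralDensity hS).1
  have hn := hasDerivAt_integral_mul_exp (S.integrable_spectralDensity hS).2
    (S.integrable_mul_spectralDensity hS).2
  rw [← sub_self t] at hp hn
  -- The factor `(2i)⁻¹` inverts the `2i` in `⟨z₊* z₊⟩ - ⟨z₋* z₋⟩`, where the `xx` and `yy` terms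
  -- cancel.
  have h := ((hp.comp_sub_const t t).sub (hn.comp_sub_const t t)).const_mul
    (((|S.e| / (2 * S.c) : ℝ) : ℂ) * (2 * Complex.I)⁻¹)
  refine (h.congr_deriv ?_).congr_of_eventuallyEq (.of_forall fun s => ?_)
  rotate_left
  · have cp := hr.circular_correlation hS hρ hf (σ := 1) (by norm_num) (s - t)
    have cn := hr.circular_correlation hS hρ hf (σ := -1) (by norm_num) (s - t)
    rw [← hr.circular_stationary, star_circular_mul hr.selfAdjoint] at cp cn
    simp only [Pi.sub_apply]
    rw [← cp, ← cn, map_sub, mul_assoc]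
    congr 1
    have := Complex.I_ne_zero
    push_cast
    field_simp
    ring
  · have hsub := congrArg (fun x : ℝ => (x : ℂ)) (S.integral_mul_spectralDensity_sub hS)
    push_cast at hsub
    rw [← mul_sub, hsub]
    have := Complex.I_ne_zero
    have hm : (S.m : ℂ) ≠ 0 := by exact_mod_cast S.m_pos.ne'
    have hc : (S.c : ℂ) ≠ 0 := by exact_mod_cast S.c_pos.ne'
    have hpi : (Real.pi : ℂ) ≠ 0 := by exact_mod_cast Real.pi_ne_zero
    push_cast
    field_simp

end DissipativeDiamagnetism

end

theorem theorem2 (S : DissipativeDiamagnetism.System) (hS : S.IsDissipative)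
    {A : Type*} [Ring A] [StarRing A] [Algebra ℂ A] [StarModule ℂ A]
    (ρ : A →ₗ[ℂ] ℂ) (hρ : DissipativeDiamagnetism.IsState ρ)
    (f : Fin 2 → SchwartzMap ℝ ℝ →ₗ[ℝ] A) (hf : DissipativeDiamagnetism.IsBathForce S ρ f)
    (r : Fin 2 → ℝ → A) (hr : DissipativeDiamagnetism.IsSteadyState S ρ f r) :
    MeasureTheory.Integrable (fun ω : ℝ =>
        S.thermalBohrMagneton ω * ω ^ 2 * (S.relaxation ω - S.relaxation (-ω))) ∧
      DissipativeDiamagnetism.IsMagneticMoment S ρ r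
        ((1 / (2 * Real.pi)) * ∫ ω : ℝ,
          S.thermalBohrMagneton ω * ω ^ 2 * (S.relaxation ω - S.relaxation (-ω))) ∧
      MeasureTheory.Integrable (fun ω : ℝ => S.thermalBohrMagneton ω * S.momentDensity ω) ∧
      DissipativeDiamagnetism.IsMagneticMoment S ρ r
        (∫ ω : ℝ, S.thermalBohrMagneton ω * S.momentDensity ω) := by
  have hM := hr.isMagneticMoment hS hρ hf
  have hi := (S.integrable_thermal hS).2.2.1
  simp_rw [S.thermalBohrMagneton_mul_sub, S.thermalBohrMagneton_mul_momentDensity]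
  -- The two forms agree because the `Φ(-ω)` term is the reflection of the `Φ(ω)` term; this
  -- doubling absorbs the factor `1/2`.
  rw [integral_const_mul, integral_const_mul, integral_add hi hi.comp_neg,
    integral_neg_eq_self (fun ω => ω * S.thermalEnergy ω * S.relaxation ω)]
  refine ⟨(hi.add hi.comp_neg).const_mul _, ?_, hi.const_mul _, hM⟩
  convert hM using 1
  field_simp
  ring
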